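/- Let $(\Omega,\mathcal F,\mathbb P)$ be a complete probability space and let $\alpha=(\alpha_t)_{t\ge 0}$ be a continuous-time irreducible Markov chain with càdlàg paths on it, with finite state space $\mathcal S=\{1,\dots,D\}$ and generator $\Pi=(\pi_{ij})_{i,j\in\mathcal S}$, where $\pi_{ij}\ge 0$ for $i\ne j$ and $\pi_{ii}=-\sum_{j\ne i}\pi_{ij}$. Let $\mathbb F=(\mathcal F_t)_{t\ge 0}$ be the natural filtration of $\alpha$ augmented by all $\mathbb P$-null sets of $\mathcal F$, and let $L^2_{\mathbb F}(\mathbb R^n)$ be the set of $\mathbb R^n$-valued $\mathbb F$-progressively measurable processes $\varphi$ with $\mathbb E\int_0^\infty|\varphi(t)|^2\,dt<\infty$. Let $A(1),\dots,A(D)\in\mathbb R^{n\times n}$ satisfy Condition (A): there are symmetric positive definite matrices $P(1),\dots,P(D)\in\mathbb R^{n\times n}$ such that $$P(i)A(i)+A(i)^\top P(i)+\sum_{j=1}^D\pi_{ij}P(j)<0\quad\text{(negative definite) for every } i\in\mathcal S.$$ Let $b\in L^2_{\mathbb F}(\mathbb R^n)$, $x\in\mathbb R^n$, $i\in\mathcal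 S$, and suppose that $\alpha_0=i$ almost surely. Then the equation $$\dot X(t)=A(\alpha_t)X(t)+b(t),\quad t\ge 0,\qquad X(0)=x,$$ understood in the sense that almost surely, for all $t\ge0$, the process $s\mapsto A(\alpha_s)X(s)+b(s)$ is integrable on $[0,t]$ and $X(t)=x+\int_0^t\big(A(\alpha_s)X(s)+b(s)\big)\,ds$, has a solution $X\in L^2_{\mathbb F}(\mathbb R^n)$, and this solution is unique up to indistinguishability: every solution $Y$ satisfies $\mathbb P(Y(t)=X(t)\text{ for all }t\ge 0)=1$. -/

import Mathlib

open MeasureTheory ProbabilityTheory Filter Topology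
open scoped NNReal ENNReal

noncomputable section

namespace RegimeSwitching

/-- The natural filtration of a process `α` with finitely many states, augmented by all the
`P`-null sets of the underlying σ-algebra. -/
def augmentedFiltration {Ω : Type*} {mΩ : MeasurableSpace Ω} (P : Measure Ω) {D : ℕ}
    (α : ℝ≥0 → Ω → Fin D) (hα : ∀ t, Measurable (α t)) : Filtration ℝ≥0 mΩ where
  seq t := Filtration.natural α (fun s => (hα s).stronglyMeasurable) t ⊔
    MeasurableSpace.generateFrom {N : Set Ω | MeasurableSet N ∧ P N = 0}
  mono' _ _ hst := sup_le_sup_right ((Filtration.natural α _).mono hst) _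
  le' t := sup_le ((Filtration.natural α _).le t)
    (MeasurableSpace.generateFrom_le fun _ hN => hN.1)

/-- `Q` is the generator (transition rate matrix) of a Markov chain on `Fin D`. -/
structure IsGenerator {D : ℕ} (Q : Matrix (Fin D) (Fin D) ℝ) : Prop where
  nonneg : ∀ i j, i ≠ j → 0 ≤ Q i j
  diag : ∀ i, Q i i = -∑ j ∈ Finset.univ.erase i, Q i j

/-- Irreducibility of the chain with generator `Q`: every state can be reached from every other
one through finitely many transitions of positive rate. -/
def IsIrreducibleGenerator {D : ℕ} (Q : Matrix (Fin D) (Fin D) ℝ) : Prop :=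
  ∀ i j, Relation.ReflTransGen (fun k l => k ≠ l ∧ 0 < Q k l) i j

/-- `α` is a continuous-time, irreducible Markov chain on `Fin D` with generator `Q` and almost
surely càdlàg paths. The Markov property is that, conditionally on the past up to time `s`, the
state at time `t ≥ s` has law given by the row `α s` of the transition matrix `exp ((t - s) Q)`. -/
structure IsMarkovChain {Ω : Type*} {mΩ : MeasurableSpace Ω} (P : Measure Ω) {D : ℕ}
    (Q : Matrix (Fin D) (Fin D) ℝ) (α : ℝ≥0 → Ω → Fin D) (hα : ∀ t, Measurable (α t)) :
    Prop where
  generator : IsGenerator Q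
  irreducible : IsIrreducibleGenerator Q
  markov : ∀ s t : ℝ≥0, s ≤ t → ∀ j : Fin D,
    P[(α t ⁻¹' {j}).indicator (fun _ => (1 : ℝ)) | augmentedFiltration P α hα s] =ᵐ[P]
      fun ω => NormedSpace.exp (((t : ℝ) - (s : ℝ)) • Q) (α s ω) j
  cadlag : ∀ᵐ ω ∂P, ∀ t : ℝ≥0, ContinuousWithinAt (fun s => α s ω) (Set.Ioi t) t ∧
    ∃ j : Fin D, Tendsto (fun s => α s ω) (𝓝[<] t) (𝓝 j)

/-- The space `L²_𝔽(ℝⁿ)`: progressively measurable processes `φ` with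
`E ∫₀^∞ |φ(t)|² dt < ∞`. -/
def MemL2F {Ω : Type*} {mΩ : MeasurableSpace Ω} (P : Measure Ω) (𝔽 : Filtration ℝ≥0 mΩ) {n : ℕ}
    (φ : ℝ≥0 → Ω → EuclideanSpace ℝ (Fin n)) : Prop :=
  IsProgressive 𝔽 φ ∧ ∫⁻ ω, (∫⁻ t in Set.Ici (0 : ℝ), ‖φ t.toNNReal ω‖ₑ ^ 2) ∂P < ∞

/-- Condition (A): there are symmetric positive definite matrices `M i` with
`M i A i + (A i)ᵀ M i + ∑ j, q_{ij} M j < 0` for every state `i`. -/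
def ConditionA {D n : ℕ} (Q : Matrix (Fin D) (Fin D) ℝ)
    (A : Fin D → Matrix (Fin n) (Fin n) ℝ) : Prop :=
  ∃ M : Fin D → Matrix (Fin n) (Fin n) ℝ, (∀ i, (M i).PosDef) ∧
    ∀ i, (-(M i * A i + (A i).transpose * M i + ∑ j, Q i j • M j)).PosDef

/-- `X` solves `Ẋ(t) = A(α_t) X(t) + b(t)`, `X(0) = x`: almost surely, for all `t ≥ 0` the right
hand side is integrable on `[0, t]` and `X(t) = x + ∫₀ᵗ (A(α_s) X(s) + b(s)) ds`.
Processes are indexed by `ℝ≥0`, and `s.toNNReal` is the real time `s ≥ 0` as such an index.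
No measurability in `ω` is asked for here, so that uniqueness holds among all processes. -/
def IsSolution {Ω : Type*} {mΩ : MeasurableSpace Ω} (P : Measure Ω) {D n : ℕ}
    (A : Fin D → Matrix (Fin n) (Fin n) ℝ) (α : ℝ≥0 → Ω → Fin D)
    (b : ℝ≥0 → Ω → EuclideanSpace ℝ (Fin n)) (x : EuclideanSpace ℝ (Fin n))
    (X : ℝ≥0 → Ω → EuclideanSpace ℝ (Fin n)) : Prop :=
  ∀ᵐ ω ∂P, ∀ t : ℝ≥0,
    IntervalIntegrable (fun s : ℝ =>
      (A (α s.toNNReal ω)).toEuclideanLin (X s.toNNReal ω) + b s.toNNReal ω) volume 0 t ∧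
    X t ω = x + ∫ s in (0 : ℝ)..t,
      ((A (α s.toNNReal ω)).toEuclideanLin (X s.toNNReal ω) + b s.toNNReal ω)

end RegimeSwitching

end

/-! For each path the equation is a linear ODE with bounded measurable coefficients, so existence
and uniqueness are pathwise. The solution is the Picard series of `f = y + ∫ a f`, with `y = x + ∫
b`; its `k`-th term is at most `C (K t)^k / k!` on bounded intervals (`norm_picardTerm_le`,
`picardSum_eq`). The explicit series also gives progressive measurability, since each term is an
iterated time integral of progressive processes. The difference of two solutions obeys the same
factorial bounds and hence vanishes (`eq_zero_of_eq_integral`); only its path is used, so no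
measurability in `ω` is needed.

The substance is `E ∫₀^∞ |X|² < ∞`. Put `V j = P(j)` and `L j = ∑ k, q_{jk} P(k)`. Condition (A) and
compactness of the sphere give `2⟪V v, A v⟫ + ⟪L v, v⟫ ≤ -δ |v|²` (`ConditionA.exists_lyapunov`).
The expected energy `E ⟪V(α) X, X⟫` has time derivative `E (2⟪V(α) X, A(α) X + b⟫ + ⟪L(α) X, X⟫)`,
which Young's inequality bounds by `-(δ/2) E|X|² + (2κ²/δ) E|b|²`. As the energy is nonnegative, `E
∫₀ᴹ |X|²` is bounded independently of `M` (`integral_norm_sq_le`), and `M → ∞` concludes.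

The energy identity needs no stochastic calculus. Over a short interval `[s, t]` the increment
splits into the change of `X` with the chain frozen at `t`, which is ordinary calculus, and the
change of the chain with `X` frozen at `s`, which is Dynkin's formula from the Markov property
(`integral_energy_sub`). Summing over a grid and refining it by dominated convergence gives
`integral_energy_eq`. -/

noncomputable section

namespace RegimeSwitching

/-! ### Linear integral equations along one path: Picard series and uniqueness. -/

section Pathwise

variable {E : Type*} [NormedAddCommGroup E]

/-- A function of `s.toNNReal` that is integrable on every `[0, t]` is integrable on every
interval. -/
theorem intervalIntegrable_toNNReal {f : ℝ≥0 → E}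
    (hf : ∀ t : ℝ≥0, IntervalIntegrable (fun s : ℝ => f s.toNNReal) volume 0 t) (u v : ℝ) :
    IntervalIntegrable (fun s : ℝ => f s.toNNReal) volume u v := by
  have key : ∀ u : ℝ, IntervalIntegrable (fun s : ℝ => f s.toNNReal) volume 0 u := by
    intro u
    rcases le_total 0 u with hu | hu
    · simpa [hu] using hf u.toNNReal
    -- On the negative half-line the integrand is the constant `f 0`.
    · refine (intervalIntegrable_const (c := f 0)).congr fun s hs => ?_
      rw [Set.uIoc_of_ge hu] at hs
      simp [Real.toNNReal_of_nonpos hs.2]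
  exact (key u).symm.trans (key v)

theorem exists_norm_le_of_continuous {y : ℝ≥0 → E} (hy : Continuous y) (T : ℝ≥0) :
    ∃ C, 0 ≤ C ∧ ∀ t ≤ T, ‖y t‖ ≤ C := by
  obtain ⟨C, hC⟩ := isCompact_Icc.exists_bound_of_continuousOn (s := Set.Icc 0 T) hy.continuousOn
  exact ⟨C, (norm_nonneg _).trans (hC 0 ⟨le_rfl, zero_le⟩), fun t ht => hC t ⟨zero_le, ht⟩⟩

variable [NormedSpace ℝ E]

theorem continuous_integral_toNNReal {f : ℝ≥0 → E}
    (hf : ∀ t : ℝ≥0, IntervalIntegrable (fun s : ℝ => f s.toNNReal) volume 0 t) :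
    Continuous fun t : ℝ≥0 => ∫ s in (0 : ℝ)..t, f s.toNNReal :=
  (intervalIntegral.continuous_primitive (intervalIntegrable_toNNReal hf) 0).comp
    NNReal.continuous_coe

/-- Integrating `s ^ k` produces the factor `1 / (k + 1)` that builds up the factorial. This one
iteration step serves both the convergence of the Picard series and uniqueness. -/
theorem norm_integral_apply_le {a : ℝ≥0 → E →L[ℝ] E} {f : ℝ≥0 → E} {K C : ℝ} {T : ℝ≥0} {k : ℕ}
    (haK : ∀ t, ‖a t‖ ≤ K)
    (hf : ∀ t ≤ T, ‖f t‖ ≤ C * (K * t) ^ k / k.factorial) {t : ℝ≥0} (ht : t ≤ T) :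
    ‖∫ s in (0 : ℝ)..t, a s.toNNReal (f s.toNNReal)‖ ≤
      C * (K * t) ^ (k + 1) / (k + 1).factorial := by
  have hK : 0 ≤ K := (norm_nonneg _).trans (haK 0)
  have hb : ∀ s ∈ Set.Ioc (0 : ℝ) t, ‖a s.toNNReal (f s.toNNReal)‖ ≤
      K * (C * K ^ k / k.factorial) * s ^ k := by
    intro s hs
    have hs' : s.toNNReal ≤ T := by
      rw [Real.toNNReal_le_iff_le_coe]; exact hs.2.trans (by exact_mod_cast ht)
    have h1 := hf s.toNNReal hs'
    rw [Real.coe_toNNReal s hs.1.le] at h1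
    calc _ ≤ ‖a s.toNNReal‖ * ‖f s.toNNReal‖ := (a s.toNNReal).le_opNorm _
      _ ≤ K * (C * (K * s) ^ k / k.factorial) :=
        mul_le_mul (haK _) h1 (norm_nonneg _) hK
      _ = _ := by rw [mul_pow]; ring
  refine (intervalIntegral.norm_integral_le_of_norm_le t.coe_nonneg
    (ae_of_all _ fun s hs => hb s hs) (Continuous.intervalIntegrable (by fun_prop) _ _)).trans
    (le_of_eq ?_)
  rw [intervalIntegral.integral_const_mul, integral_pow, Nat.factorial_succ, mul_pow]
  push_cast
  rw [zero_pow k.succ_ne_zero, sub_zero]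
  field_simp
  ring

/-- The terms of the Picard series of `f t = y t + ∫₀ᵗ a s (f s) ds`. -/
def picardTerm (a : ℝ≥0 → E →L[ℝ] E) (y : ℝ≥0 → E) : ℕ → ℝ≥0 → E
  | 0 => y
  | k + 1 => fun t => ∫ s in (0 : ℝ)..t, a s.toNNReal (picardTerm a y k s.toNNReal)

/-- The sum of the Picard series of `f t = y t + ∫₀ᵗ a s (f s) ds`. -/
def picardSum (a : ℝ≥0 → E →L[ℝ] E) (y : ℝ≥0 → E) (t : ℝ≥0) : E :=
  ∑' k, picardTerm a y k t

theorem norm_picardTerm_le {a : ℝ≥0 → E →L[ℝ] E} {y : ℝ≥0 → E} {K C : ℝ} {T : ℝ≥0}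
    (haK : ∀ t, ‖a t‖ ≤ K) (hy : ∀ t ≤ T, ‖y t‖ ≤ C) (k : ℕ) :
    ∀ t ≤ T, ‖picardTerm a y k t‖ ≤ C * (K * t) ^ k / k.factorial := by
  induction k with
  | zero => simpa [picardTerm] using hy
  | succ k ih => exact fun t ht => norm_integral_apply_le haK ih ht

theorem aestronglyMeasurable_apply_toNNReal {a : ℝ≥0 → E →L[ℝ] E} (ha : StronglyMeasurable a)
    {f : ℝ≥0 → E} (hf : StronglyMeasurable f) (μ : Measure ℝ) :
    AEStronglyMeasurable (fun s : ℝ => a s.toNNReal (f s.toNNReal)) μ :=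
  ((isBoundedBilinearMap_apply.continuous.comp_stronglyMeasurable
    (ha.prodMk hf)).comp_measurable measurable_real_toNNReal).aestronglyMeasurable

theorem intervalIntegrable_apply_toNNReal {a : ℝ≥0 → E →L[ℝ] E} (ha : StronglyMeasurable a)
    {K : ℝ} (haK : ∀ t, ‖a t‖ ≤ K) {f : ℝ≥0 → E} (hf : StronglyMeasurable f) {C : ℝ} {T : ℝ≥0}
    (hfC : ∀ t ≤ T, ‖f t‖ ≤ C) :
    IntervalIntegrable (fun s : ℝ => a s.toNNReal (f s.toNNReal)) volume 0 T := by
  have hK : 0 ≤ K := (norm_nonneg _).trans (haK 0)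
  refine (intervalIntegrable_const (c := K * C)).mono_fun
    (aestronglyMeasurable_apply_toNNReal ha hf _) ?_
  filter_upwards [ae_restrict_mem measurableSet_uIoc] with s hs
  rw [Set.uIoc_of_le T.coe_nonneg] at hs
  have hs' : s.toNNReal ≤ T := by rw [Real.toNNReal_le_iff_le_coe]; exact hs.2
  refine ((a s.toNNReal).le_opNorm _).trans ((mul_le_mul (haK _) (hfC _ hs') (norm_nonneg _)
    hK).trans (le_abs_self _))

theorem continuous_picardTerm {a : ℝ≥0 → E →L[ℝ] E} (ha : StronglyMeasurable a)
    {K : ℝ} (haK : ∀ t, ‖a t‖ ≤ K) {y : ℝ≥0 → E} (hy : Continuous y) (k : ℕ) :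
    Continuous (picardTerm a y k) := by
  induction k with
  | zero => exact hy
  | succ k ih =>
    refine continuous_integral_toNNReal (f := fun s => a s (picardTerm a y k s)) fun t => ?_
    obtain ⟨C, -, hC⟩ := exists_norm_le_of_continuous ih t
    exact intervalIntegrable_apply_toNNReal ha haK ih.stronglyMeasurable hC

theorem norm_picardSum_le {a : ℝ≥0 → E →L[ℝ] E} {K C : ℝ} (haK : ∀ t, ‖a t‖ ≤ K)
    {y : ℝ≥0 → E} {T : ℝ≥0} (hC : ∀ t ≤ T, ‖y t‖ ≤ C) {t : ℝ≥0} (ht : t ≤ T) :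
    ‖picardSum a y t‖ ≤ C * Real.exp (K * T) := by
  have hK : 0 ≤ K := (norm_nonneg _).trans (haK 0)
  have hC0 : 0 ≤ C := (norm_nonneg _).trans (hC 0 zero_le)
  have h1 : HasSum (fun k => C * ((K * t) ^ k / k.factorial)) (C * Real.exp (K * t)) := by
    rw [Real.exp_eq_exp_ℝ]
    exact (NormedSpace.expSeries_div_hasSum_exp (K * (t : ℝ))).mul_left C
  refine (tsum_of_norm_bounded h1 fun k => ?_).trans ?_
  · have := norm_picardTerm_le haK hC k t ht
    rwa [mul_div_assoc] at this
  · have : (t : ℝ) ≤ T := by exact_mod_cast ht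
    gcongr

/-- The linear equation `f' = a f`, `f 0 = 0` has only the zero solution. -/
theorem eq_zero_of_eq_integral {a : ℝ≥0 → E →L[ℝ] E} {K : ℝ} (haK : ∀ t, ‖a t‖ ≤ K)
    {f : ℝ≥0 → E}
    (hint : ∀ t : ℝ≥0, IntervalIntegrable (fun s : ℝ => a s.toNNReal (f s.toNNReal)) volume 0 t)
    (hf : ∀ t : ℝ≥0, f t = ∫ s in (0 : ℝ)..t, a s.toNNReal (f s.toNNReal)) (t : ℝ≥0) :
    f t = 0 := by
  -- Being a primitive, `f` is continuous, hence bounded on `[0, t]`; this starts the iteration.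
  have hcont : Continuous f := by
    rw [show f = _ from funext hf]
    exact continuous_integral_toNNReal (f := fun s => a s (f s)) hint
  obtain ⟨C, -, hC⟩ := exists_norm_le_of_continuous hcont t
  have hk : ∀ k : ℕ, ∀ s ≤ t, ‖f s‖ ≤ C * (K * s) ^ k / k.factorial := by
    intro k
    induction k with
    | zero => simpa using hC
    | succ k ih =>
      intro s hs
      rw [hf s]
      exact norm_integral_apply_le haK ih hs
  have hlim : Tendsto (fun k : ℕ => C * (K * t) ^ k / k.factorial) atTop (𝓝 0) := by
    simpa [mul_div_assoc] using
      ((FloorSemiring.tendsto_pow_div_factorial_atTop (K * (t : ℝ))).const_mul C)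
  exact norm_le_zero_iff.1 (ge_of_tendsto' hlim fun k => hk k t le_rfl)

variable [CompleteSpace E]

theorem hasSum_picardTerm {a : ℝ≥0 → E →L[ℝ] E} {K : ℝ} (haK : ∀ t, ‖a t‖ ≤ K)
    {y : ℝ≥0 → E} (hy : Continuous y) (t : ℝ≥0) :
    HasSum (fun k => picardTerm a y k t) (picardSum a y t) := by
  obtain ⟨C, -, hC⟩ := exists_norm_le_of_continuous hy t
  have hle : ∀ k, ‖picardTerm a y k t‖ ≤ C * ((K * t) ^ k / k.factorial) := fun k => by
    rw [← mul_div_assoc]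
    exact norm_picardTerm_le haK hC k t le_rfl
  have hsum : Summable fun k : ℕ => C * ((K * t) ^ k / k.factorial) :=
    (Real.summable_pow_div_factorial _).mul_left C
  exact (Summable.of_norm_bounded hsum hle).hasSum

theorem stronglyMeasurable_picardSum {a : ℝ≥0 → E →L[ℝ] E} (ha : StronglyMeasurable a) {K : ℝ}
    (haK : ∀ t, ‖a t‖ ≤ K) {y : ℝ≥0 → E} (hy : Continuous y) :
    StronglyMeasurable (picardSum a y) :=
  StronglyMeasurable.hasSum
    (fun k => (continuous_picardTerm ha haK hy k).stronglyMeasurable) (hasSum_picardTerm haK hy)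

theorem intervalIntegrable_apply_picardSum {a : ℝ≥0 → E →L[ℝ] E} (ha : StronglyMeasurable a)
    {K : ℝ} (haK : ∀ t, ‖a t‖ ≤ K) {y : ℝ≥0 → E} (hy : Continuous y) (t : ℝ≥0) :
    IntervalIntegrable (fun s : ℝ => a s.toNNReal (picardSum a y s.toNNReal)) volume 0 t := by
  obtain ⟨C, -, hC⟩ := exists_norm_le_of_continuous hy t
  exact intervalIntegrable_apply_toNNReal ha haK (stronglyMeasurable_picardSum ha haK hy)
    fun s hs => norm_picardSum_le haK hC hs

/-- The integral operator may be applied termwise, the exponential series dominating, and it shifts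
the Picard series by one index; the missing zeroth term is `y t`. -/
theorem picardSum_eq {a : ℝ≥0 → E →L[ℝ] E} (ha : StronglyMeasurable a) {K : ℝ}
    (haK : ∀ t, ‖a t‖ ≤ K) {y : ℝ≥0 → E} (hy : Continuous y) (t : ℝ≥0) :
    picardSum a y t = y t + ∫ s in (0 : ℝ)..t, a s.toNNReal (picardSum a y s.toNNReal) := by
  have hK : 0 ≤ K := (norm_nonneg _).trans (haK 0)
  obtain ⟨C, hC0, hC⟩ := exists_norm_le_of_continuous hy t
  have hsum : Summable fun k : ℕ => K * (C * ((K * t) ^ k / k.factorial)) :=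
    ((Real.summable_pow_div_factorial _).mul_left C).mul_left K
  have h1 : HasSum (fun k => picardTerm a y (k + 1) t)
      (∫ s in (0 : ℝ)..t, a s.toNNReal (picardSum a y s.toNNReal)) := by
    refine intervalIntegral.hasSum_integral_of_dominated_convergence
      (fun k _ => K * (C * ((K * t) ^ k / k.factorial))) (fun k =>
        aestronglyMeasurable_apply_toNNReal ha
          (continuous_picardTerm ha haK hy k).stronglyMeasurable _) ?_
      (ae_of_all _ fun _ _ => hsum) intervalIntegrable_const
      (ae_of_all _ fun s _ => (hasSum_picardTerm haK hy _).mapL (a s.toNNReal))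
    refine fun k => ae_of_all _ fun s hs => ?_
    rw [Set.uIoc_of_le t.coe_nonneg] at hs
    have hs' : s.toNNReal ≤ t := by rw [Real.toNNReal_le_iff_le_coe]; exact hs.2
    have h2 := norm_picardTerm_le haK hC k s.toNNReal hs'
    rw [mul_div_assoc] at h2
    refine ((a s.toNNReal).le_opNorm _).trans (mul_le_mul (haK _) (h2.trans ?_) (norm_nonneg _) hK)
    have : (s.toNNReal : ℝ) ≤ t := by exact_mod_cast hs'
    gcongr
  have h2 := (hasSum_nat_add_iff' (f := fun k => picardTerm a y k t) 1).2
    (hasSum_picardTerm haK hy t)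
  have h3 := h1.unique h2
  rw [h3]
  simp [picardTerm]

theorem continuous_picardSum {a : ℝ≥0 → E →L[ℝ] E} (ha : StronglyMeasurable a) {K : ℝ}
    (haK : ∀ t, ‖a t‖ ≤ K) {y : ℝ≥0 → E} (hy : Continuous y) : Continuous (picardSum a y) := by
  rw [show picardSum a y = fun t : ℝ≥0 => y t + ∫ s in (0 : ℝ)..t,
    a s.toNNReal (picardSum a y s.toNNReal) from funext (picardSum_eq ha haK hy)]
  exact hy.add (continuous_integral_toNNReal (f := fun s => a s (picardSum a y s))
    (intervalIntegrable_apply_picardSum ha haK hy))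

end Pathwise

/-! ### Uniform time grids of mesh `1 / (N + 1)`. -/

section Grid

/-- The largest multiple of `1 / (N + 1)` that is at most `u`. -/
def gridLower (N : ℕ) (u : ℝ≥0) : ℝ≥0 := ⌊u * (N + 1)⌋₊ / (N + 1)

/-- The smallest multiple of `1 / (N + 1)` that is larger than `u`. -/
def gridUpper (N : ℕ) (u : ℝ≥0) : ℝ≥0 := (⌊u * (N + 1)⌋₊ + 1) / (N + 1)

theorem gridLower_le (N : ℕ) (u : ℝ≥0) : gridLower N u ≤ u := by
  rw [gridLower, div_le_iff₀ (by positivity)]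
  exact Nat.floor_le zero_le

theorem lt_gridUpper (N : ℕ) (u : ℝ≥0) : u < gridUpper N u := by
  rw [gridUpper, lt_div_iff₀ (by positivity)]
  exact Nat.lt_floor_add_one _

theorem gridUpper_eq (N : ℕ) (u : ℝ≥0) : gridUpper N u = gridLower N u + 1 / (N + 1) := by
  rw [gridUpper, gridLower, add_div]

/-- Every natural number is a point of every grid, so rounding up a smaller time does not pass it.
-/
theorem gridUpper_le_natCast {N M : ℕ} {u : ℝ≥0} (hu : u < M) : gridUpper N u ≤ M := by
  rw [gridUpper, div_le_iff₀ (by positivity)]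
  have : ⌊u * (N + 1)⌋₊ < M * (N + 1) := by
    rw [Nat.floor_lt zero_le]
    push_cast
    exact mul_lt_mul_of_pos_right hu (by positivity)
  exact_mod_cast this

theorem measurable_gridLower (N : ℕ) : Measurable (gridLower N) := by
  unfold gridLower; fun_prop

theorem measurable_gridUpper (N : ℕ) : Measurable (gridUpper N) := by
  unfold gridUpper; fun_prop

theorem tendsto_one_div_natCast_add_one : Tendsto (fun N : ℕ => (1 : ℝ≥0) / (N + 1)) atTop (𝓝 0) :=
  tendsto_one_div_add_atTop_nhds_zero_nat

theorem tendsto_gridUpper (u : ℝ≥0) : Tendsto (fun N => gridUpper N u) atTop (𝓝[>] u) := by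
  refine tendsto_nhdsWithin_iff.2 ⟨?_, .of_forall fun N => lt_gridUpper N u⟩
  refine tendsto_of_tendsto_of_tendsto_of_le_of_le (h := fun N : ℕ => u + 1 / (N + 1))
    tendsto_const_nhds (by simpa using tendsto_one_div_natCast_add_one.const_add u)
    (fun N => (lt_gridUpper N u).le) fun N => ?_
  simp only [gridUpper_eq]
  gcongr
  exact gridLower_le N u

theorem tendsto_gridLower (u : ℝ≥0) : Tendsto (fun N => gridLower N u) atTop (𝓝 u) := by
  refine tendsto_of_tendsto_of_tendsto_of_le_of_le (g := fun N : ℕ => u - 1 / (N + 1))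
    (by simpa using tendsto_one_div_natCast_add_one.const_sub u)
    tendsto_const_nhds (fun N => ?_) (fun N => gridLower_le N u)
  simp only [tsub_le_iff_right, ← gridUpper_eq]
  exact (lt_gridUpper N u).le

end Grid

/-! ### Progressive measurability of limits, integrals and Picard terms. -/

section Progressive

variable {Ω : Type*}

section Fixed

variable {m : MeasurableSpace Ω} {β : Type*} [MeasurableSpace β]

theorem measurable_stopped {T : ℝ≥0} {u : ℝ≥0 → Ω → β}
    (hu : Measurable fun p : Set.Iic T × Ω => u p.1 p.2) :
    Measurable fun p : ℝ≥0 × Ω => u (min p.1 T) p.2 :=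
  hu.comp (Measurable.prodMk ((measurable_fst.min measurable_const).subtype_mk
    (h := fun p => Set.mem_Iic.2 (min_le_right p.1 T))) measurable_snd)

/-- The variable upper limit is moved into an indicator, which leaves a parametric integral over a
fixed space. Capping the time at `T` keeps the integrand within the range where `u` is known to be
measurable. -/
theorem measurable_integral_of_measurable_Iic {E : Type*} [NormedAddCommGroup E] [NormedSpace ℝ E]
    [MeasurableSpace E] [BorelSpace E] [SecondCountableTopology E]
    {T : ℝ≥0} {u : ℝ≥0 → Ω → E} (hu : Measurable fun p : Set.Iic T × Ω => u p.1 p.2) :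
    Measurable fun p : Set.Iic T × Ω => ∫ s in (0 : ℝ)..(p.1 : ℝ≥0), u s.toNNReal p.2 := by
  let g : (Set.Iic T × Ω) × ℝ → E := fun q =>
    {q : (Set.Iic T × Ω) × ℝ | 0 < q.2 ∧ q.2 ≤ ((q.1.1 : ℝ≥0) : ℝ)}.indicator
      (fun q => u (min q.2.toNNReal T) q.1.2) q
  have hg : Measurable g := by
    refine Measurable.indicator ?_ ?_
    · exact (measurable_stopped hu).comp
        ((measurable_real_toNNReal.comp measurable_snd).prodMk
          (measurable_snd.comp measurable_fst))
    · refine (measurableSet_lt measurable_const measurable_snd).inter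
        (measurableSet_le measurable_snd ?_)
      fun_prop
  have heq : (fun p : Set.Iic T × Ω => ∫ s in (0 : ℝ)..(p.1 : ℝ≥0), u s.toNNReal p.2) =
      fun p => ∫ s, g (p, s) := by
    ext p
    rw [intervalIntegral.integral_of_le (NNReal.coe_nonneg _),
      ← integral_indicator measurableSet_Ioc]
    refine integral_congr_ae (ae_of_all _ fun s => ?_)
    by_cases hs : s ∈ Set.Ioc (0 : ℝ) (p.1 : ℝ≥0)
    · have hsT : s.toNNReal ≤ T := (Real.toNNReal_le_iff_le_coe.2 hs.2).trans p.1.2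
      have hs' : (p, s) ∈ {q : (Set.Iic T × Ω) × ℝ | 0 < q.2 ∧ q.2 ≤ ((q.1.1 : ℝ≥0) : ℝ)} := hs
      simp only [g, Set.indicator_of_mem hs, Set.indicator_of_mem hs', min_eq_left hsT]
    · have hs' : (p, s) ∉ {q : (Set.Iic T × Ω) × ℝ | 0 < q.2 ∧ q.2 ≤ ((q.1.1 : ℝ≥0) : ℝ)} := hs
      simp only [g, Set.indicator_of_notMem hs, Set.indicator_of_notMem hs']
  rw [heq]
  exact (hg.stronglyMeasurable.integral_prod_right' (ν := volume)).measurable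

/-- The process is the pointwise limit of its values at the next grid time, capped at `T` so that
nothing after `T` is consulted. -/
theorem measurable_Iic_of_rightContinuous [TopologicalSpace β] [TopologicalSpace.PseudoMetrizableSpace β]
    [BorelSpace β] {T : ℝ≥0} {u : ℝ≥0 → Ω → β} (hu : ∀ t ≤ T, Measurable (u t))
    (hcont : ∀ ω t, ContinuousWithinAt (fun s => u s ω) (Set.Ioi t) t) :
    Measurable fun p : Set.Iic T × Ω => u p.1 p.2 := by
  refine measurable_of_tendsto_metrizable (f := fun (N : ℕ) (p : Set.Iic T × Ω) =>
    u (min (gridUpper N p.1) T) p.2) (fun N => ?_) ?_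
  -- For fixed `N` time enters only through an integer, so measurability can be checked one integer
  -- at a time.
  · have h1 : Measurable fun q : ℕ × Ω => u (min ((q.1 + 1) / (N + 1)) T) q.2 :=
      measurable_from_prod_countable_right fun k =>
        hu (min ((k + 1) / (N + 1)) T) (min_le_right _ _)
    have h2 : Measurable fun p : Set.Iic T × Ω => (⌊(p.1 : ℝ≥0) * (N + 1)⌋₊, p.2) := by fun_prop
    simpa only [gridUpper, Function.comp_def] using h1.comp h2
  · refine tendsto_pi_nhds.2 fun p => ?_
    -- At time `T` the cap makes the sequence constant, so it approaches within `≥` and not within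
    -- `>`.
    have hmin : Tendsto (fun N => min (gridUpper N p.1) T) atTop (𝓝[≥] (p.1 : ℝ≥0)) := by
      refine tendsto_nhdsWithin_iff.2 ⟨?_, .of_forall fun N => le_min (lt_gridUpper N _).le p.1.2⟩
      have := ((tendsto_gridUpper (p.1 : ℝ≥0)).mono_right nhdsWithin_le_nhds).min
        (tendsto_const_nhds (x := T))
      rwa [min_eq_left (show (p.1 : ℝ≥0) ≤ T from p.1.2)] at this
    exact (continuousWithinAt_Ioi_iff_Ici.1 (hcont p.2 p.1)).tendsto.comp hmin

end Fixed

variable {mΩ : MeasurableSpace Ω} {𝔽 : Filtration ℝ≥0 mΩ} {β : Type*} [MeasurableSpace β]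

theorem isProgressive_of_rightContinuous [TopologicalSpace β] [TopologicalSpace.PseudoMetrizableSpace β]
    [BorelSpace β] {u : ℝ≥0 → Ω → β} (hu : ∀ t, Measurable[𝔽 t] (u t))
    (hcont : ∀ ω t, ContinuousWithinAt (fun s => u s ω) (Set.Ioi t) t) :
    IsProgressive 𝔽 u := fun T =>
  measurable_Iic_of_rightContinuous (m := 𝔽 T)
    (fun t ht => (hu t).mono (𝔽.mono ht) le_rfl) hcont

theorem isProgressive_integral {E : Type*} [NormedAddCommGroup E] [NormedSpace ℝ E]
    [MeasurableSpace E] [BorelSpace E] [SecondCountableTopology E] {u : ℝ≥0 → Ω → E}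
    (hu : IsProgressive 𝔽 u) :
    IsProgressive 𝔽 fun t ω => ∫ s in (0 : ℝ)..t, u s.toNNReal ω := fun T =>
  measurable_integral_of_measurable_Iic (m := 𝔽 T) (hu T)

theorem isProgressive_tsum {E : Type*} [NormedAddCommGroup E] [CompleteSpace E]
    [MeasurableSpace E] [BorelSpace E] [SecondCountableTopology E] {u : ℕ → ℝ≥0 → Ω → E}
    (hu : ∀ k, IsProgressive 𝔽 (u k)) : IsProgressive 𝔽 fun t ω => ∑' k, u k t ω := fun T => by
  let _ : MeasurableSpace Ω := 𝔽 T
  exact (StronglyMeasurable.tsum fun k => (hu k T).stronglyMeasurable).measurable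

theorem isProgressive_indicator {E : Type*} [Zero E] [MeasurableSpace E] {u : ℝ≥0 → Ω → E}
    (hu : IsProgressive 𝔽 u) {s : Set Ω} (hs : ∀ t, MeasurableSet[𝔽 t] s) :
    IsProgressive 𝔽 fun t => s.indicator (u t) := fun T => by
  let _ : MeasurableSpace Ω := 𝔽 T
  exact (hu T).indicator (s := {p : Set.Iic T × Ω | p.2 ∈ s}) (measurable_snd (hs T))

theorem measurable_uncurry_of_isProgressive [TopologicalSpace β] [TopologicalSpace.PseudoMetrizableSpace β]
    [BorelSpace β] {u : ℝ≥0 → Ω → β} (hu : IsProgressive 𝔽 u) :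
    Measurable fun p : ℝ≥0 × Ω => u p.1 p.2 := by
  refine measurable_of_tendsto_metrizable (f := fun (N : ℕ) (p : ℝ≥0 × Ω) => u (min p.1 N) p.2)
    (fun N => ?_) (tendsto_pi_nhds.2 fun p => ?_)
  · exact measurable_stopped ((hu N).mono (sup_le_sup_left (MeasurableSpace.comap_mono (𝔽.le N)) _)
      le_rfl)
  · obtain ⟨N, hN⟩ := exists_nat_ge p.1
    refine tendsto_const_nhds.congr' ((eventually_ge_atTop N).mono fun k hk => ?_)
    simp only [min_eq_left (hN.trans (Nat.cast_le.2 hk))]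

/-- The Picard terms of an equation with random, progressive coefficients are progressive. -/
theorem isProgressive_picardTerm {E : Type*} [NormedAddCommGroup E] [NormedSpace ℝ E]
    [MeasurableSpace E] [BorelSpace E] [SecondCountableTopology E] {ι : Type*} [Countable ι]
    [MeasurableSpace ι] [MeasurableSingletonClass ι] (B : ι → E →L[ℝ] E) {α : ℝ≥0 → Ω → ι}
    (hα : IsProgressive 𝔽 α) {y : ℝ≥0 → Ω → E} (hy : IsProgressive 𝔽 y) (k : ℕ) :
    IsProgressive 𝔽 fun t ω => picardTerm (fun s => B (α s ω)) (fun s => y s ω) k t := by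
  induction k with
  | zero => exact hy
  | succ k ih =>
    refine isProgressive_integral
      (u := fun s ω => B (α s ω) (picardTerm (fun s => B (α s ω)) (fun s => y s ω) k s))
      fun T => ?_
    let _ : MeasurableSpace Ω := 𝔽 T
    have h1 : Measurable fun q : ι × E => B q.1 q.2 :=
      measurable_from_prod_countable_right fun j => (B j).continuous.measurable
    exact h1.comp (Measurable.prodMk (hα T) (ih T))

end Progressive

/-! ### Differentiating the entries of `exp (t Q)`. -/

section MatrixExp

variable {ι : Type*} [Fintype ι] [DecidableEq ι]

theorem hasDerivAt_exp_smul_apply (Q : Matrix ι ι ℝ) (l k : ι) (t : ℝ) :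
    HasDerivAt (fun t : ℝ => NormedSpace.exp (t • Q) l k) ((NormedSpace.exp (t • Q) * Q) l k) t := by
  -- A norm is chosen locally for calculus; the statement involves only the topology.
  let _ : NormedRing (Matrix ι ι ℝ) := Matrix.linftyOpNormedRing
  let _ : NormedAlgebra ℝ (Matrix ι ι ℝ) := Matrix.linftyOpNormedAlgebra
  exact ((Matrix.entryLinearMap ℝ ℝ l k).toContinuousLinearMap).hasFDerivAt.comp_hasDerivAt t
    (hasDerivAt_exp_smul_const Q t)

theorem continuous_exp_smul_apply (Q : Matrix ι ι ℝ) (l k : ι) :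
    Continuous fun t : ℝ => NormedSpace.exp (t • Q) l k :=
  continuous_iff_continuousAt.2 fun t => (hasDerivAt_exp_smul_apply Q l k t).continuousAt

end MatrixExp

/-! ### The Markov property and Dynkin's formula. -/

section Dynkin

variable {Ω : Type*} {mΩ : MeasurableSpace Ω} {P : Measure Ω}
  {𝔽 : Filtration ℝ≥0 mΩ} {D : ℕ} {Q : Matrix (Fin D) (Fin D) ℝ} {α : ℝ≥0 → Ω → Fin D}

/-- The Markov property of `α` with respect to `𝔽`, with the transition matrices `exp (t Q)`. -/
def HasMarkovProperty (P : Measure Ω) (𝔽 : Filtration ℝ≥0 mΩ) {D : ℕ}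
    (Q : Matrix (Fin D) (Fin D) ℝ) (α : ℝ≥0 → Ω → Fin D) : Prop :=
  ∀ s t : ℝ≥0, s ≤ t → ∀ j : Fin D,
    P[(α t ⁻¹' {j}).indicator (fun _ => (1 : ℝ)) | 𝔽 s] =ᵐ[P]
      fun ω => NormedSpace.exp (((t : ℝ) - (s : ℝ)) • Q) (α s ω) j

theorem apply_eq_sum_indicator {a : Ω → Fin D} (g : Fin D → Ω → ℝ) (ω : Ω) :
    g (a ω) ω = ∑ j, (a ⁻¹' {j}).indicator (g j) ω := by
  rw [Finset.sum_eq_single (a ω)]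
  · simp
  · intro j _ hj
    exact Set.indicator_of_notMem (by simpa using hj.symm) _
  · simp

theorem integral_apply_eq_sum {a : Ω → Fin D} (ha : Measurable a) {g : Fin D → Ω → ℝ}
    (hg : ∀ j, Integrable (g j) P) :
    ∫ ω, g (a ω) ω ∂P = ∑ j, ∫ ω, (a ⁻¹' {j}).indicator (g j) ω ∂P := by
  simp_rw [apply_eq_sum_indicator g]
  exact integral_finsetSum _ fun j _ => (hg j).indicator (ha (measurableSet_singleton j))

theorem integrable_apply {a : Ω → Fin D} (ha : Measurable a) {g : Fin D → Ω → ℝ}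
    (hg : ∀ j, Integrable (g j) P) : Integrable (fun ω => g (a ω) ω) P := by
  simp_rw [apply_eq_sum_indicator g]
  exact integrable_finsetSum _ fun j _ => (hg j).indicator (ha (measurableSet_singleton j))

variable [IsProbabilityMeasure P]

/-- Conditioning on `𝔽 s` pulls out the weight `W` and replaces the indicator by a transition
probability from `α s`, which is then split according to the state at time `s`. -/
theorem integral_indicator_preimage (hM : HasMarkovProperty P 𝔽 Q α) (hα : ∀ t, Measurable (α t))
    {s t : ℝ≥0} (hst : s ≤ t) (j : Fin D) {W : Ω → ℝ} (hW : StronglyMeasurable[𝔽 s] W)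
    (hWi : Integrable W P) :
    ∫ ω, (α t ⁻¹' {j}).indicator W ω ∂P =
      ∑ l, NormedSpace.exp (((t : ℝ) - (s : ℝ)) • Q) l j *
        ∫ ω, (α s ⁻¹' {l}).indicator W ω ∂P := by
  have hmeas : MeasurableSet (α t ⁻¹' {j}) := hα t (measurableSet_singleton j)
  have h1 : (α t ⁻¹' {j}).indicator W = (α t ⁻¹' {j}).indicator (fun _ => (1 : ℝ)) * W := by
    ext ω
    by_cases h : ω ∈ α t ⁻¹' {j} <;> simp [h]
  have h2 := condExp_mul_of_stronglyMeasurable_right hW (h1 ▸ hWi.indicator hmeas)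
    ((integrable_const (1 : ℝ)).indicator hmeas)
  rw [h1, ← integral_condExp (𝔽.le s), integral_congr_ae (h2.trans ((hM s t hst j).mul .rfl))]
  have h3 := integral_apply_eq_sum (P := P) (hα s)
    (g := fun l ω => NormedSpace.exp (((t : ℝ) - (s : ℝ)) • Q) l j * W ω) fun l => hWi.const_mul _
  refine h3.trans (Finset.sum_congr rfl fun l _ => ?_)
  rw [← integral_const_mul]
  refine integral_congr_ae (ae_of_all _ fun ω => ?_)
  by_cases h : ω ∈ α s ⁻¹' {l} <;> simp [h]

/-- Dynkin's formula for functions `W (α t)` whose coefficients are known at time `s`. -/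
theorem integral_apply_sub_integral_apply (hM : HasMarkovProperty P 𝔽 Q α)
    (hα : ∀ t, Measurable (α t)) {s t : ℝ≥0} (hst : s ≤ t) {W : Fin D → Ω → ℝ}
    (hW : ∀ k, StronglyMeasurable[𝔽 s] (W k)) (hWi : ∀ k, Integrable (W k) P) :
    ∫ ω, W (α t ω) ω ∂P - ∫ ω, W (α s ω) ω ∂P =
      ∫ u in (s : ℝ)..t, ∫ ω, ∑ k, Q (α u.toNNReal ω) k * W k ω ∂P := by
  -- With these time-independent weights, `E W(α_v)` for `v ≥ s` is the smooth function `F v`, and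
  -- the formula becomes the fundamental theorem of calculus for `F`.
  set c : Fin D → Fin D → ℝ := fun l k => ∫ ω, (α s ⁻¹' {l}).indicator (W k) ω ∂P with hc
  set F : ℝ → ℝ := fun v => ∑ k, ∑ l, NormedSpace.exp ((v - s) • Q) l k * c l k with hF
  set DF : ℝ → ℝ := fun v => ∑ k, ∑ l, (NormedSpace.exp ((v - s) • Q) * Q) l k * c l k with hDF
  have hval : ∀ r : ℝ≥0, s ≤ r → ∫ ω, W (α r ω) ω ∂P = F r := fun r hr => by
    rw [integral_apply_eq_sum (hα r) hWi]
    exact Finset.sum_congr rfl fun k _ => integral_indicator_preimage hM hα hr k (hW k) (hWi k)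
  have hder : ∀ v, HasDerivAt F (DF v) v := fun v => by
    refine HasDerivAt.fun_sum fun k _ => HasDerivAt.fun_sum fun l _ => HasDerivAt.mul_const ?_ _
    exact (hasDerivAt_exp_smul_apply Q l k (v - s)).comp_sub_const v s
  have hcont : Continuous DF := by
    simp only [hDF, Matrix.mul_apply]
    refine continuous_finsetSum _ fun k _ => continuous_finsetSum _ fun l _ =>
      (continuous_finsetSum _ fun j _ => Continuous.mul ?_ continuous_const).mul continuous_const
    exact (continuous_exp_smul_apply Q l j).comp (by fun_prop : Continuous fun v : ℝ => v - s)
  rw [hval t hst, hval s le_rfl, ← intervalIntegral.integral_eq_sub_of_hasDerivAt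
    (fun v _ => hder v) (hcont.intervalIntegrable _ _)]
  have hst' : (s : ℝ) ≤ t := by exact_mod_cast hst
  refine intervalIntegral.integral_congr fun u hu => ?_
  rw [Set.uIcc_of_le hst'] at hu
  have hsu : s ≤ u.toNNReal := NNReal.le_toNNReal_of_coe_le hu.1
  have hu0 : ((u.toNNReal : ℝ≥0) : ℝ) = u := Real.coe_toNNReal u (s.coe_nonneg.trans hu.1)
  rw [integral_apply_eq_sum (P := P) (hα u.toNNReal) (g := fun j ω => ∑ k, Q j k * W k ω)
    fun j => integrable_finsetSum _ fun k _ => (hWi k).const_mul _]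
  -- Summing over the state `j` at time `u` assembles the product `exp ((u - s) Q) Q` found in `DF`.
  have hterm : ∀ j, ∫ ω, (α u.toNNReal ⁻¹' {j}).indicator (fun ω => ∑ k, Q j k * W k ω) ω ∂P =
      ∑ k, Q j k * ∑ l, NormedSpace.exp ((u - s) • Q) l j * c l k := fun j => by
    have : (α u.toNNReal ⁻¹' {j}).indicator (fun ω => ∑ k, Q j k * W k ω) =
        fun ω => ∑ k, Q j k * (α u.toNNReal ⁻¹' {j}).indicator (W k) ω := by
      ext ω
      by_cases h : ω ∈ α u.toNNReal ⁻¹' {j} <;> simp [h]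
    rw [this, integral_finsetSum _ fun k _ =>
      ((hWi k).indicator (hα _ (measurableSet_singleton j))).const_mul _]
    refine Finset.sum_congr rfl fun k _ => ?_
    rw [integral_const_mul, integral_indicator_preimage hM hα hsu j (hW k) (hWi k), hu0]
  simp only [hterm, hDF, Matrix.mul_apply, Finset.sum_mul, Finset.mul_sum]
  conv_rhs => rw [Finset.sum_comm]
  refine Finset.sum_congr rfl fun k _ => ?_
  conv_rhs => rw [Finset.sum_comm]
  exact Finset.sum_congr rfl fun l _ => Finset.sum_congr rfl fun j _ => by ring

end Dynkin

/-! ### Increment of the expected energy over one interval. -/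

section Energy

variable {Ω : Type*} {mΩ : MeasurableSpace Ω} {P : Measure Ω} {D : ℕ}
  {E : Type*} [NormedAddCommGroup E] [InnerProductSpace ℝ E]

/-- The integrand in the formula for the increments of `E ⟪V(α) X, X⟫` along
`X' = B(α) X + b`, where `L = Q V`: the process `X` and the chain inside `V` are frozen at the
end points `σ` and `τ` of a time interval that contains `u`. -/
def energyIntegrand (V B L : Fin D → E →L[ℝ] E) (α : ℝ≥0 → Ω → Fin D) (b X : ℝ≥0 → Ω → E)
    (σ τ u : ℝ≥0) (ω : Ω) : ℝ :=
  inner ℝ (V (α τ ω) (X τ ω + X σ ω)) (B (α u ω) (X u ω) + b u ω) +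
    inner ℝ (L (α u ω) (X σ ω)) (X σ ω)

/-- The bound does not depend on `σ`, `τ`, so it dominates all grid approximations at once. The
mixed term is absorbed by `2 r |b| ≤ r² + |b|²` with `r = √ρ`. -/
theorem abs_energyIntegrand_le {V B L : Fin D → E →L[ℝ] E} {κ : ℝ} (hV : ∀ j, ‖V j‖ ≤ κ)
    (hB : ∀ j, ‖B j‖ ≤ κ) (hL : ∀ j, ‖L j‖ ≤ κ) {α : ℝ≥0 → Ω → Fin D} {b X : ℝ≥0 → Ω → E}
    {σ τ u : ℝ≥0} {ω : Ω} {ρ : ℝ} (hσ : ‖X σ ω‖ ^ 2 ≤ ρ) (hτ : ‖X τ ω‖ ^ 2 ≤ ρ)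
    (hu : ‖X u ω‖ ^ 2 ≤ ρ) :
    |energyIntegrand V B L α b X σ τ u ω| ≤ (2 * κ ^ 2 + 2 * κ) * ρ + κ * ‖b u ω‖ ^ 2 := by
  have hκ : 0 ≤ κ := (norm_nonneg _).trans (hV (α 0 ω))
  have hρ : 0 ≤ ρ := (sq_nonneg _).trans hσ
  set r := √ρ with hr
  have hr0 : 0 ≤ r := Real.sqrt_nonneg _
  have hrr : r ^ 2 = ρ := Real.sq_sqrt hρ
  have hσ' : ‖X σ ω‖ ≤ r := Real.le_sqrt_of_sq_le hσ
  have hτ' : ‖X τ ω‖ ≤ r := Real.le_sqrt_of_sq_le hτ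
  have hu' : ‖X u ω‖ ≤ r := Real.le_sqrt_of_sq_le hu
  have h1 : ‖V (α τ ω) (X τ ω + X σ ω)‖ ≤ κ * (r + r) :=
    (ContinuousLinearMap.le_opNorm _ _).trans (mul_le_mul (hV _)
      ((norm_add_le _ _).trans (add_le_add hτ' hσ')) (norm_nonneg _) hκ)
  have h2 : ‖B (α u ω) (X u ω) + b u ω‖ ≤ κ * r + ‖b u ω‖ :=
    (norm_add_le _ _).trans (add_le_add_left ((ContinuousLinearMap.le_opNorm _ _).trans
      (mul_le_mul (hB _) hu' (norm_nonneg _) hκ)) _)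
  have h3 : ‖L (α u ω) (X σ ω)‖ ≤ κ * r :=
    (ContinuousLinearMap.le_opNorm _ _).trans (mul_le_mul (hL _) hσ' (norm_nonneg _) hκ)
  calc |energyIntegrand V B L α b X σ τ u ω|
      ≤ κ * (r + r) * (κ * r + ‖b u ω‖) + κ * r * r := by
        refine (abs_add_le _ _).trans (add_le_add ?_ ?_)
        · exact (abs_real_inner_le_norm _ _).trans (mul_le_mul h1 h2 (norm_nonneg _) (by positivity))
        · exact (abs_real_inner_le_norm _ _).trans
            (mul_le_mul h3 hσ' (norm_nonneg _) (by positivity))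
    _ ≤ _ := by
        rw [← hrr]
        nlinarith [mul_nonneg hκ (sq_nonneg (r - ‖b u ω‖))]

theorem restrict_prod_eq (S : Set ℝ) [SFinite P] :
    (volume.restrict S).prod P = (volume.prod P).restrict (S ×ˢ Set.univ) := by
  rw [← Measure.prod_restrict, Measure.restrict_univ]

variable [MeasurableSpace E] [BorelSpace E] [SecondCountableTopology E]

theorem measurable_energyIntegrand (V B L : Fin D → E →L[ℝ] E) {α : ℝ≥0 → Ω → Fin D}
    {b X : ℝ≥0 → Ω → E} (hα : Measurable fun p : ℝ≥0 × Ω => α p.1 p.2)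
    (hb : Measurable fun p : ℝ≥0 × Ω => b p.1 p.2) (hX : Measurable fun p : ℝ≥0 × Ω => X p.1 p.2)
    {σ τ : ℝ → ℝ≥0} (hσ : Measurable σ) (hτ : Measurable τ) :
    Measurable fun p : ℝ × Ω =>
      energyIntegrand V B L α b X (σ p.1) (τ p.1) p.1.toNNReal p.2 := by
  have happ : ∀ A : Fin D → E →L[ℝ] E, Measurable fun q : Fin D × E => A q.1 q.2 := fun A =>
    measurable_from_prod_countable_right fun j => (A j).continuous.measurable
  have hpσ : Measurable fun p : ℝ × Ω => (σ p.1, p.2) := by fun_prop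
  have hpτ : Measurable fun p : ℝ × Ω => (τ p.1, p.2) := by fun_prop
  have hpu : Measurable fun p : ℝ × Ω => (p.1.toNNReal, p.2) := by fun_prop
  refine Measurable.add (Measurable.inner ?_ ?_) (Measurable.inner ?_ (hX.comp hpσ))
  · exact (happ V).comp ((hα.comp hpτ).prodMk ((hX.comp hpτ).add (hX.comp hpσ)))
  · exact ((happ B).comp ((hα.comp hpu).prodMk (hX.comp hpu))).add (hb.comp hpu)
  · exact (happ L).comp ((hα.comp hpu).prodMk (hX.comp hpσ))

variable [IsProbabilityMeasure P]

theorem integrable_const_mul_add_const_mul {g : ℝ × Ω → ℝ} {ρ : Ω → ℝ} (hρ : Integrable ρ P)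
    (hg : Integrable g ((volume.restrict (Set.Ici 0)).prod P)) {S : Set ℝ} (hS0 : S ⊆ Set.Ici 0)
    (hSfin : volume S < ∞) (c κ : ℝ) :
    Integrable (fun p : ℝ × Ω => c * ρ p.2 + κ * g p) ((volume.restrict S).prod P) := by
  have : IsFiniteMeasure (volume.restrict S) := ⟨by simpa using hSfin⟩
  refine ((hρ.comp_snd _).const_mul c).add (Integrable.const_mul ?_ κ)
  rw [restrict_prod_eq] at hg ⊢
  exact IntegrableOn.mono_set hg (Set.prod_mono_left hS0)

theorem integrable_energyIntegrand {V B L : Fin D → E →L[ℝ] E} {κ : ℝ} (hV : ∀ j, ‖V j‖ ≤ κ)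
    (hB : ∀ j, ‖B j‖ ≤ κ) (hL : ∀ j, ‖L j‖ ≤ κ) {α : ℝ≥0 → Ω → Fin D}
    {b X : ℝ≥0 → Ω → E} (hα : Measurable fun p : ℝ≥0 × Ω => α p.1 p.2)
    (hb : Measurable fun p : ℝ≥0 × Ω => b p.1 p.2) (hX : Measurable fun p : ℝ≥0 × Ω => X p.1 p.2)
    {T : ℝ≥0} {ρ : Ω → ℝ} (hρ : Integrable ρ P) (hXρ : ∀ t ≤ T, ∀ ω, ‖X t ω‖ ^ 2 ≤ ρ ω)
    (hbi : Integrable (fun p : ℝ × Ω => ‖b p.1.toNNReal p.2‖ ^ 2)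
      ((volume.restrict (Set.Ici 0)).prod P))
    {σ τ : ℝ → ℝ≥0} (hσ : Measurable σ) (hτ : Measurable τ) {S : Set ℝ} (hS : MeasurableSet S)
    (hS0 : S ⊆ Set.Icc 0 T) (hσT : ∀ᵐ u ∂volume.restrict S, σ u ≤ T)
    (hτT : ∀ᵐ u ∂volume.restrict S, τ u ≤ T) :
    Integrable (fun p : ℝ × Ω =>
      energyIntegrand V B L α b X (σ p.1) (τ p.1) p.1.toNNReal p.2)
      ((volume.restrict S).prod P) := by
  refine (integrable_const_mul_add_const_mul hρ hbi (hS0.trans Set.Icc_subset_Ici_self)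
    ((measure_mono hS0).trans_lt (by simp)) (2 * κ ^ 2 + 2 * κ) κ).mono'
    (measurable_energyIntegrand V B L hα hb hX hσ hτ).aestronglyMeasurable ?_
  have hae : ∀ᵐ u ∂volume.restrict S, u ∈ S ∧ σ u ≤ T ∧ τ u ≤ T := by
    filter_upwards [ae_restrict_mem hS, hσT, hτT] with u h1 h2 h3 using ⟨h1, h2, h3⟩
  filter_upwards [Measure.quasiMeasurePreserving_fst.ae hae] with p hp
  exact abs_energyIntegrand_le hV hB hL (hXρ _ hp.2.1 _) (hXρ _ hp.2.2 _)
    (hXρ _ (Real.toNNReal_le_iff_le_coe.2 (hS0 hp.1).2) _)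

variable [CompleteSpace E]

/-- Insert the intermediate value `⟪V(α_t) X_s, X_s⟫`. By symmetry of `V` the first difference is
`⟪V(α_t) (X_t + X_s), X_t - X_s⟫`, where `X_t - X_s` is the integral of the equation. In the second
difference the coefficients `⟪V_k X_s, X_s⟫` are known at time `s`, so Dynkin's formula applies. -/
theorem integral_energy_sub {𝔽 : Filtration ℝ≥0 mΩ} {Q : Matrix (Fin D) (Fin D) ℝ}
    {V B L : Fin D → E →L[ℝ] E} {κ : ℝ} (hV : ∀ j, ‖V j‖ ≤ κ)
    (hB : ∀ j, ‖B j‖ ≤ κ) (hL : ∀ j, ‖L j‖ ≤ κ)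
    (hVsymm : ∀ j v w, inner ℝ (V j v) w = inner ℝ v (V j w))
    (hLV : ∀ j v, inner ℝ (L j v) v = ∑ k, Q j k * inner ℝ (V k v) v)
    {α : ℝ≥0 → Ω → Fin D} (hM : HasMarkovProperty P 𝔽 Q α)
    {b X : ℝ≥0 → Ω → E} (hα : Measurable fun p : ℝ≥0 × Ω => α p.1 p.2)
    (hb : Measurable fun p : ℝ≥0 × Ω => b p.1 p.2) (hX : Measurable fun p : ℝ≥0 × Ω => X p.1 p.2)
    (hXad : ∀ t, Measurable[𝔽 t] (X t))
    {T : ℝ≥0} {ρ : Ω → ℝ} (hρ : Integrable ρ P) (hXρ : ∀ t ≤ T, ∀ ω, ‖X t ω‖ ^ 2 ≤ ρ ω)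
    (hbi : Integrable (fun p : ℝ × Ω => ‖b p.1.toNNReal p.2‖ ^ 2)
      ((volume.restrict (Set.Ici 0)).prod P)) {x : E}
    (hint : ∀ ω, ∀ t : ℝ≥0, IntervalIntegrable (fun s : ℝ =>
      B (α s.toNNReal ω) (X s.toNNReal ω) + b s.toNNReal ω) volume 0 t)
    (hXeq : ∀ ω, ∀ t : ℝ≥0, X t ω = x + ∫ s in (0 : ℝ)..t,
      (B (α s.toNNReal ω) (X s.toNNReal ω) + b s.toNNReal ω))
    {s t : ℝ≥0} (hst : s ≤ t) (htT : t ≤ T) :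
    ∫ ω, inner ℝ (V (α t ω) (X t ω)) (X t ω) ∂P - ∫ ω, inner ℝ (V (α s ω) (X s ω)) (X s ω) ∂P =
      ∫ u in (s : ℝ)..t, ∫ ω, energyIntegrand V B L α b X s t u.toNNReal ω ∂P := by
  -- The sign of `κ` follows from `hV` only if a state exists; a sample point supplies one.
  have hκ : ∀ _ : Ω, 0 ≤ κ := fun ω => (norm_nonneg _).trans (hV (α 0 ω))
  have hst' : (s : ℝ) ≤ t := by exact_mod_cast hst
  have hS0 : Set.Ioc (s : ℝ) t ⊆ Set.Icc 0 T := fun u hu =>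
    ⟨s.coe_nonneg.trans hu.1.le, hu.2.trans (by exact_mod_cast htT)⟩
  have hαt : ∀ r, Measurable (α r) := fun r => hα.comp measurable_prodMk_left
  have hXt : ∀ r, Measurable (X r) := fun r => hX.comp measurable_prodMk_left
  have hWi : ∀ r ≤ T, ∀ k, Integrable (fun ω => inner ℝ (V k (X r ω)) (X r ω)) P := by
    intro r hr k
    refine (hρ.const_mul κ).mono' (Measurable.inner ((V k).measurable.comp (hXt r))
      (hXt r)).aestronglyMeasurable (ae_of_all _ fun ω => ?_)
    calc _ ≤ ‖V k (X r ω)‖ * ‖X r ω‖ := norm_inner_le_norm _ _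
      _ ≤ κ * ‖X r ω‖ * ‖X r ω‖ := by
        gcongr
        exact (ContinuousLinearMap.le_opNorm _ _).trans
          (mul_le_mul_of_nonneg_right (hV k) (norm_nonneg _))
      _ = κ * ‖X r ω‖ ^ 2 := by ring
      _ ≤ κ * ρ ω := mul_le_mul_of_nonneg_left (hXρ r hr ω) (hκ ω)
  have hG : Integrable (fun p : ℝ × Ω => energyIntegrand V B L α b X s t p.1.toNNReal p.2)
      ((volume.restrict (Set.Ioc (s : ℝ) t)).prod P) :=
    integrable_energyIntegrand hV hB hL hα hb hX hρ hXρ hbi measurable_const measurable_const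
      measurableSet_Ioc hS0 (ae_of_all _ fun _ => hst.trans htT) (ae_of_all _ fun _ => htT)
  have hG1 : Integrable (fun p : ℝ × Ω => inner ℝ (V (α t p.2) (X t p.2 + X s p.2))
      (B (α p.1.toNNReal p.2) (X p.1.toNNReal p.2) + b p.1.toNNReal p.2))
      ((volume.restrict (Set.Ioc (s : ℝ) t)).prod P) := by
    -- Taking `L = 0` isolates the first summand; the second is then a difference of integrable
    -- functions.
    have := integrable_energyIntegrand (L := 0) (P := P) hV hB
      (fun j => (norm_nonneg (V j)).trans (hV j) |>.trans' (by simp)) hα hb hX hρ hXρ hbi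
      (σ := fun _ => s) (τ := fun _ => t) measurable_const measurable_const
      measurableSet_Ioc hS0 (ae_of_all _ fun _ => hst.trans htT) (ae_of_all _ fun _ => htT)
    simpa [energyIntegrand] using this
  have hG2 : Integrable (fun p : ℝ × Ω => inner ℝ (L (α p.1.toNNReal p.2) (X s p.2)) (X s p.2))
      ((volume.restrict (Set.Ioc (s : ℝ) t)).prod P) := by
    refine (hG.sub hG1).congr (ae_of_all _ fun p => ?_)
    simp [energyIntegrand]
  have h1 : ∫ ω, inner ℝ (V (α t ω) (X t ω)) (X t ω) ∂P -
      ∫ ω, inner ℝ (V (α t ω) (X s ω)) (X s ω) ∂P =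
      ∫ p, inner ℝ (V (α t p.2) (X t p.2 + X s p.2))
        (B (α p.1.toNNReal p.2) (X p.1.toNNReal p.2) + b p.1.toNNReal p.2)
        ∂((volume.restrict (Set.Ioc (s : ℝ) t)).prod P) := by
    rw [integral_prod_symm _ hG1, ← integral_sub
      (integrable_apply (hαt t) (g := fun k ω => inner ℝ (V k (X t ω)) (X t ω)) (hWi t htT))
      (integrable_apply (hαt t) (g := fun k ω => inner ℝ (V k (X s ω)) (X s ω))
        (hWi s (hst.trans htT)))]
    refine integral_congr_ae (ae_of_all _ fun ω => ?_)
    have hii : IntervalIntegrable (fun r : ℝ =>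
        B (α r.toNNReal ω) (X r.toNNReal ω) + b r.toNNReal ω) volume s t :=
      (hint ω s).symm.trans (hint ω t)
    have hdiff : X t ω - X s ω = ∫ r in (s : ℝ)..t,
        (B (α r.toNNReal ω) (X r.toNNReal ω) + b r.toNNReal ω) := by
      rw [hXeq ω t, hXeq ω s, add_sub_add_left_eq_sub,
        intervalIntegral.integral_interval_sub_left (hint ω t) (hint ω s)]
    dsimp only
    rw [integral_inner ((intervalIntegrable_iff_integrableOn_Ioc_of_le hst').1 hii),
      ← intervalIntegral.integral_of_le hst', ← hdiff]
    simp only [map_add, inner_add_left, inner_sub_right]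
    rw [hVsymm _ (X s ω) (X t ω), real_inner_comm (V (α t ω) (X t ω)) (X s ω)]
    ring
  have h2 : ∫ ω, inner ℝ (V (α t ω) (X s ω)) (X s ω) ∂P -
      ∫ ω, inner ℝ (V (α s ω) (X s ω)) (X s ω) ∂P =
      ∫ p, inner ℝ (L (α p.1.toNNReal p.2) (X s p.2)) (X s p.2)
        ∂((volume.restrict (Set.Ioc (s : ℝ) t)).prod P) := by
    have hWm : ∀ k, StronglyMeasurable[𝔽 s] (fun ω => inner ℝ (V k (X s ω)) (X s ω)) := fun k => by
      let _ : MeasurableSpace Ω := 𝔽 s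
      exact (Measurable.inner ((V k).measurable.comp (hXad s)) (hXad s)).stronglyMeasurable
    rw [integral_prod _ hG2, ← intervalIntegral.integral_of_le hst']
    simp only [hLV]
    exact integral_apply_sub_integral_apply hM hαt hst
      (W := fun k ω => inner ℝ (V k (X s ω)) (X s ω)) hWm (hWi s (hst.trans htT))
  rw [← sub_add_sub_cancel, h1, h2, ← integral_add hG1 hG2, intervalIntegral.integral_of_le hst']
  exact integral_prod _ hG

end Energy

/-! ### Energy identity by grid refinement, and the resulting estimate. -/

section EnergyIdentity

variable {Ω : Type*} {mΩ : MeasurableSpace Ω} {P : Measure Ω} [IsProbabilityMeasure P] {D : ℕ}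
  {E : Type*} [NormedAddCommGroup E] [InnerProductSpace ℝ E] [CompleteSpace E]
  [MeasurableSpace E] [BorelSpace E] [SecondCountableTopology E]

theorem gridLower_eq_of_mem {N k : ℕ} {u : ℝ≥0} (h1 : k / (N + 1) ≤ u)
    (h2 : u < (k + 1) / (N + 1)) : gridLower N u = k / (N + 1) ∧ gridUpper N u = (k + 1) / (N + 1) := by
  have hfl : ⌊u * (N + 1)⌋₊ = k := by
    rw [Nat.floor_eq_iff zero_le]
    exact ⟨(div_le_iff₀ (by positivity)).1 h1, (lt_div_iff₀ (by positivity)).1 h2⟩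
  simp [gridLower, gridUpper, hfl]

/-- Only the endpoint `u = M`, a null set, is rounded up beyond `M`. -/
theorem ae_restrict_gridUpper_le (N M : ℕ) :
    ∀ᵐ u ∂(volume : Measure ℝ).restrict (Set.Ioc 0 (M : ℝ)), gridUpper N u.toNNReal ≤ M := by
  filter_upwards [ae_restrict_mem measurableSet_Ioc, ae_restrict_of_ae (Measure.ae_ne volume (M : ℝ))]
    with u hu hne
  refine gridUpper_le_natCast ?_
  rw [← NNReal.coe_lt_coe, Real.coe_toNNReal u hu.1.le]
  exact lt_of_le_of_ne hu.2 hne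

/-- The change of the expected energy `E ⟪V(α) X, X⟫` along `X' = B(α) X + b`. -/
theorem integral_energy_eq {𝔽 : Filtration ℝ≥0 mΩ} {Q : Matrix (Fin D) (Fin D) ℝ}
    {V B L : Fin D → E →L[ℝ] E} {κ : ℝ} (hV : ∀ j, ‖V j‖ ≤ κ)
    (hB : ∀ j, ‖B j‖ ≤ κ) (hL : ∀ j, ‖L j‖ ≤ κ)
    (hVsymm : ∀ j v w, inner ℝ (V j v) w = inner ℝ v (V j w))
    (hLV : ∀ j v, inner ℝ (L j v) v = ∑ k, Q j k * inner ℝ (V k v) v)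
    {α : ℝ≥0 → Ω → Fin D} (hM : HasMarkovProperty P 𝔽 Q α)
    (hαcont : ∀ ω t, ContinuousWithinAt (fun s => α s ω) (Set.Ioi t) t)
    {b X : ℝ≥0 → Ω → E} (hα : Measurable fun p : ℝ≥0 × Ω => α p.1 p.2)
    (hb : Measurable fun p : ℝ≥0 × Ω => b p.1 p.2) (hX : Measurable fun p : ℝ≥0 × Ω => X p.1 p.2)
    (hXad : ∀ t, Measurable[𝔽 t] (X t)) (hXcont : ∀ ω, Continuous fun t => X t ω)
    {M : ℕ} {ρ : Ω → ℝ} (hρ : Integrable ρ P) (hXρ : ∀ t ≤ (M : ℝ≥0), ∀ ω, ‖X t ω‖ ^ 2 ≤ ρ ω)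
    (hbi : Integrable (fun p : ℝ × Ω => ‖b p.1.toNNReal p.2‖ ^ 2)
      ((volume.restrict (Set.Ici 0)).prod P)) {x : E}
    (hint : ∀ ω, ∀ t : ℝ≥0, IntervalIntegrable (fun s : ℝ =>
      B (α s.toNNReal ω) (X s.toNNReal ω) + b s.toNNReal ω) volume 0 t)
    (hXeq : ∀ ω, ∀ t : ℝ≥0, X t ω = x + ∫ s in (0 : ℝ)..t,
      (B (α s.toNNReal ω) (X s.toNNReal ω) + b s.toNNReal ω)) :
    ∫ ω, inner ℝ (V (α M ω) (X M ω)) (X M ω) ∂P - ∫ ω, inner ℝ (V (α 0 ω) (X 0 ω)) (X 0 ω) ∂P =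
      ∫ p, energyIntegrand V B L α b X p.1.toNNReal p.1.toNNReal p.1.toNNReal p.2
        ∂((volume.restrict (Set.Ioc 0 (M : ℝ))).prod P) := by
  set μ := ((volume : Measure ℝ).restrict (Set.Ioc 0 (M : ℝ))).prod P with hμ
  set f : ℝ≥0 → ℝ := fun t => ∫ ω, inner ℝ (V (α t ω) (X t ω)) (X t ω) ∂P with hf
  have hS0 : Set.Ioc (0 : ℝ) M ⊆ Set.Icc 0 ((M : ℝ≥0) : ℝ) := by
    simpa using Set.Ioc_subset_Icc_self
  set G : ℕ → ℝ × Ω → ℝ := fun N p => energyIntegrand V B L α b X (gridLower N p.1.toNNReal)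
    (gridUpper N p.1.toNNReal) p.1.toNNReal p.2 with hG
  have hGmeas : ∀ N, Measurable (G N) := fun N => measurable_energyIntegrand V B L hα hb hX
    ((measurable_gridLower N).comp measurable_real_toNNReal)
    ((measurable_gridUpper N).comp measurable_real_toNNReal)
  have hbound : ∀ N, ∀ᵐ p ∂μ,
      ‖G N p‖ ≤ (2 * κ ^ 2 + 2 * κ) * ρ p.2 + κ * ‖b p.1.toNNReal p.2‖ ^ 2 := fun N => by
    filter_upwards [Measure.quasiMeasurePreserving_fst.ae (ae_restrict_gridUpper_le N M)] with p hp
    have hle := (lt_gridUpper N p.1.toNNReal).le.trans hp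
    exact abs_energyIntegrand_le hV hB hL (hXρ _ ((gridLower_le N _).trans hle) _) (hXρ _ hp _)
      (hXρ _ hle _)
  have hdom : Integrable (fun p : ℝ × Ω =>
      (2 * κ ^ 2 + 2 * κ) * ρ p.2 + κ * ‖b p.1.toNNReal p.2‖ ^ 2) μ :=
    integrable_const_mul_add_const_mul hρ hbi (hS0.trans Set.Icc_subset_Ici_self) (by simp) _ _
  have hGint : ∀ N, Integrable (G N) μ := fun N =>
    hdom.mono' (hGmeas N).aestronglyMeasurable (hbound N)
  -- For each grid the one-interval identities telescope exactly, since `M` is the grid point of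
  -- index `M * (N + 1)`; no error term arises before the limit.
  have hstep : ∀ N, ∫ p, G N p ∂μ = f M - f 0 := fun N => by
    set a : ℕ → ℝ≥0 := fun k => k / (N + 1) with ha
    have haM : a (M * (N + 1)) = M := by
      simp only [ha]; push_cast; field_simp
    have ha1 : ∀ k, a (k + 1) = (k + 1) / (N + 1) := fun k => by simp [ha]
    have hmono : Monotone a := fun k l hkl => by
      simp only [ha]
      gcongr
    have hii : IntervalIntegrable (fun u => ∫ ω, G N (u, ω) ∂P) volume 0 M :=
      (intervalIntegrable_iff_integrableOn_Ioc_of_le (Nat.cast_nonneg M)).2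
        (hGint N).integral_prod_left
    have hk : ∀ k < M * (N + 1), f (a (k + 1)) - f (a k) =
        ∫ u in (a k : ℝ)..a (k + 1), ∫ ω, G N (u, ω) ∂P := by
      intro k hk
      have hle : a k ≤ a (k + 1) := hmono k.le_succ
      rw [integral_energy_sub hV hB hL hVsymm hLV hM hα hb hX hXad hρ hXρ hbi hint hXeq hle
        (haM ▸ hmono hk)]
      -- The right endpoint already rounds to the next cell, so it is discarded as a null set.
      have hne : ∀ᵐ u : ℝ, u ≠ a (k + 1) := Measure.ae_ne volume _
      refine intervalIntegral.integral_congr_ae (hne.mono fun u hu hmem => ?_)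
      rw [Set.uIoc_of_le (by exact_mod_cast hle)] at hmem
      have hu0 : 0 ≤ u := (a k).coe_nonneg.trans hmem.1.le
      obtain ⟨e1, e2⟩ := gridLower_eq_of_mem (N := N) (k := k) (u := u.toNNReal)
        (NNReal.le_toNNReal_of_coe_le hmem.1.le) (by
          rw [← ha1, ← NNReal.coe_lt_coe, Real.coe_toNNReal u hu0]
          exact lt_of_le_of_ne hmem.2 hu)
      simp only [hG, e1, e2, ha1]
      rfl
    have hsum := intervalIntegral.sum_integral_adjacent_intervals (μ := volume)
      (f := fun u => ∫ ω, G N (u, ω) ∂P) (a := fun k => (a k : ℝ)) (n := M * (N + 1))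
      fun k hk => hii.mono_set (by
        rw [Set.uIcc_of_le (by exact_mod_cast hmono k.le_succ), Set.uIcc_of_le (Nat.cast_nonneg M)]
        refine Set.Icc_subset_Icc (NNReal.coe_nonneg _) ?_
        have : a (k + 1) ≤ M := haM ▸ hmono hk
        exact_mod_cast this)
    rw [← Finset.sum_congr rfl fun k hk' => hk k (Finset.mem_range.1 hk'),
      Finset.sum_range_sub (fun k => f (a k)), haM] at hsum
    rw [integral_prod _ (hGint N), ← intervalIntegral.integral_of_le (Nat.cast_nonneg M)]
    have ha0 : a 0 = 0 := by simp [ha]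
    rw [ha0] at hsum
    simpa using hsum.symm
  have hlim : Tendsto (fun N => ∫ p, G N p ∂μ) atTop (𝓝 (∫ p, energyIntegrand V B L α b X
      p.1.toNNReal p.1.toNNReal p.1.toNNReal p.2 ∂μ)) := by
    refine tendsto_integral_of_dominated_convergence _
      (fun N => (hGmeas N).aestronglyMeasurable) hdom hbound (ae_of_all _ fun p => ?_)
    have hup := tendsto_gridUpper p.1.toNNReal
    have hXup : Tendsto (fun N => X (gridUpper N p.1.toNNReal) p.2) atTop
        (𝓝 (X p.1.toNNReal p.2)) :=
      ((hXcont p.2).tendsto _).comp (hup.mono_right nhdsWithin_le_nhds)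
    have hXlo : Tendsto (fun N => X (gridLower N p.1.toNNReal) p.2) atTop
        (𝓝 (X p.1.toNNReal p.2)) := ((hXcont p.2).tendsto _).comp (tendsto_gridLower _)
    -- Grid times decrease to `u` strictly from above, and a right-continuous path in a discrete
    -- space is constant just after `u`.
    have hαup : ∀ᶠ N in atTop, α (gridUpper N p.1.toNNReal) p.2 = α p.1.toNNReal p.2 :=
      tendsto_pure.1 (by
        have := (hαcont p.2 p.1.toNNReal).tendsto.comp hup
        rwa [nhds_discrete] at this)
    have hVup : Tendsto (fun N => V (α (gridUpper N p.1.toNNReal) p.2)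
        (X (gridUpper N p.1.toNNReal) p.2 + X (gridLower N p.1.toNNReal) p.2)) atTop
        (𝓝 (V (α p.1.toNNReal p.2) (X p.1.toNNReal p.2 + X p.1.toNNReal p.2))) := by
      refine Tendsto.congr' (hαup.mono fun N hN => by simp only [Function.comp_apply, hN])
        (((V (α p.1.toNNReal p.2)).continuous.tendsto _).comp (hXup.add hXlo))
    exact (hVup.inner tendsto_const_nhds).add
      ((((L (α p.1.toNNReal p.2)).continuous.tendsto _).comp hXlo).inner hXlo)
  simp only [hstep] at hlim
  exact tendsto_nhds_unique tendsto_const_nhds hlim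

/-- The energy estimate: if `V` is a Lyapunov function then `E ∫₀ᴹ |X|²` is bounded by
the initial datum and `E ∫₀^∞ |b|²`. -/
theorem integral_norm_sq_le {𝔽 : Filtration ℝ≥0 mΩ} {Q : Matrix (Fin D) (Fin D) ℝ}
    {V B L : Fin D → E →L[ℝ] E} {κ : ℝ} (hV : ∀ j, ‖V j‖ ≤ κ)
    (hB : ∀ j, ‖B j‖ ≤ κ) (hL : ∀ j, ‖L j‖ ≤ κ)
    (hVsymm : ∀ j v w, inner ℝ (V j v) w = inner ℝ v (V j w))
    (hVpos : ∀ j v, 0 ≤ inner ℝ (V j v) v)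
    (hLV : ∀ j v, inner ℝ (L j v) v = ∑ k, Q j k * inner ℝ (V k v) v)
    {δ : ℝ} (hδ : 0 < δ)
    (hLyap : ∀ j v, 2 * inner ℝ (V j v) (B j v) + inner ℝ (L j v) v ≤ -δ * ‖v‖ ^ 2)
    {α : ℝ≥0 → Ω → Fin D} (hM : HasMarkovProperty P 𝔽 Q α)
    (hαcont : ∀ ω t, ContinuousWithinAt (fun s => α s ω) (Set.Ioi t) t)
    {b X : ℝ≥0 → Ω → E} (hα : Measurable fun p : ℝ≥0 × Ω => α p.1 p.2)
    (hb : Measurable fun p : ℝ≥0 × Ω => b p.1 p.2) (hX : Measurable fun p : ℝ≥0 × Ω => X p.1 p.2)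
    (hXad : ∀ t, Measurable[𝔽 t] (X t)) (hXcont : ∀ ω, Continuous fun t => X t ω)
    {M : ℕ} {ρ : Ω → ℝ} (hρ : Integrable ρ P) (hXρ : ∀ t ≤ (M : ℝ≥0), ∀ ω, ‖X t ω‖ ^ 2 ≤ ρ ω)
    (hbi : Integrable (fun p : ℝ × Ω => ‖b p.1.toNNReal p.2‖ ^ 2)
      ((volume.restrict (Set.Ici 0)).prod P)) {x : E}
    (hint : ∀ ω, ∀ t : ℝ≥0, IntervalIntegrable (fun s : ℝ =>
      B (α s.toNNReal ω) (X s.toNNReal ω) + b s.toNNReal ω) volume 0 t)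
    (hXeq : ∀ ω, ∀ t : ℝ≥0, X t ω = x + ∫ s in (0 : ℝ)..t,
      (B (α s.toNNReal ω) (X s.toNNReal ω) + b s.toNNReal ω)) :
    Integrable (fun p : ℝ × Ω => ‖X p.1.toNNReal p.2‖ ^ 2)
      ((volume.restrict (Set.Ioc 0 (M : ℝ))).prod P) ∧
    ∫ p, ‖X p.1.toNNReal p.2‖ ^ 2 ∂((volume.restrict (Set.Ioc 0 (M : ℝ))).prod P) ≤
      2 / δ * (κ * ‖x‖ ^ 2 + 2 * κ ^ 2 / δ * ∫ p, ‖b p.1.toNNReal p.2‖ ^ 2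
        ∂((volume.restrict (Set.Ici (0 : ℝ))).prod P)) := by
  have hS0 : Set.Ioc (0 : ℝ) M ⊆ Set.Icc 0 ((M : ℝ≥0) : ℝ) := by
    simpa using Set.Ioc_subset_Icc_self
  have hid := integral_energy_eq hV hB hL hVsymm hLV hM hαcont hα hb hX hXad hXcont hρ hXρ hbi
    hint hXeq
  have hpu : Measurable fun p : ℝ × Ω => (p.1.toNNReal, p.2) := by fun_prop
  have hGint : Integrable (fun p : ℝ × Ω => energyIntegrand V B L α b X p.1.toNNReal p.1.toNNReal
      p.1.toNNReal p.2) ((volume.restrict (Set.Ioc 0 (M : ℝ))).prod P) := by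
    have hT : ∀ᵐ u : ℝ ∂volume.restrict (Set.Ioc 0 (M : ℝ)), u.toNNReal ≤ (M : ℝ≥0) :=
      (ae_restrict_mem measurableSet_Ioc).mono fun u hu =>
        Real.toNNReal_le_iff_le_coe.2 (hS0 hu).2
    exact integrable_energyIntegrand hV hB hL hα hb hX hρ hXρ hbi measurable_real_toNNReal
      measurable_real_toNNReal measurableSet_Ioc hS0 hT hT
  have hbM : Integrable (fun p : ℝ × Ω => ‖b p.1.toNNReal p.2‖ ^ 2)
      ((volume.restrict (Set.Ioc 0 (M : ℝ))).prod P) := by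
    -- The coefficients `0` and `1` leave just the restriction of `hbi` to the bounded time
    -- interval.
    simpa using integrable_const_mul_add_const_mul hρ hbi (hS0.trans Set.Icc_subset_Ici_self)
      (by simp) 0 1
  have hbmono : ∫ p, ‖b p.1.toNNReal p.2‖ ^ 2 ∂((volume.restrict (Set.Ioc 0 (M : ℝ))).prod P) ≤
      ∫ p, ‖b p.1.toNNReal p.2‖ ^ 2 ∂((volume.restrict (Set.Ici (0 : ℝ))).prod P) := by
    rw [restrict_prod_eq] at hbi ⊢
    rw [restrict_prod_eq]
    exact setIntegral_mono_set hbi (ae_of_all _ fun _ => by positivity)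
      (Set.prod_mono_left (hS0.trans Set.Icc_subset_Ici_self)).eventuallyLE
  have hXint : Integrable (fun p : ℝ × Ω => ‖X p.1.toNNReal p.2‖ ^ 2)
      ((volume.restrict (Set.Ioc 0 (M : ℝ))).prod P) := by
    refine (hρ.comp_snd _).mono' ((hX.comp hpu).norm.pow_const 2).aestronglyMeasurable ?_
    filter_upwards [Measure.quasiMeasurePreserving_fst.ae
      (ae_restrict_mem (μ := volume) (measurableSet_Ioc (a := (0 : ℝ)) (b := M)))] with p hp
    rw [Real.norm_of_nonneg (by positivity)]
    exact hXρ _ (Real.toNNReal_le_iff_le_coe.2 (hS0 hp).2) _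
  refine ⟨hXint, ?_⟩
  have hpt : ∀ p : ℝ × Ω, δ / 2 * ‖X p.1.toNNReal p.2‖ ^ 2 ≤
      2 * κ ^ 2 / δ * ‖b p.1.toNNReal p.2‖ ^ 2 - energyIntegrand V B L α b X p.1.toNNReal
        p.1.toNNReal p.1.toNNReal p.2 := fun p => by
    have hL1 := hLyap (α p.1.toNNReal p.2) (X p.1.toNNReal p.2)
    have hκ : 0 ≤ κ := (norm_nonneg _).trans (hV (α 0 p.2))
    set j := α p.1.toNNReal p.2
    set v := X p.1.toNNReal p.2
    set w := b p.1.toNNReal p.2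
    have hin : inner ℝ (V j v) w ≤ κ * ‖v‖ * ‖w‖ :=
      (real_inner_le_norm _ _).trans (mul_le_mul_of_nonneg_right
        ((ContinuousLinearMap.le_opNorm _ _).trans
          (mul_le_mul_of_nonneg_right (hV j) (norm_nonneg _))) (norm_nonneg _))
    have hE : energyIntegrand V B L α b X p.1.toNNReal p.1.toNNReal p.1.toNNReal p.2 =
        2 * inner ℝ (V j v) (B j v) + inner ℝ (L j v) v + 2 * inner ℝ (V j v) w := by
      simp only [energyIntegrand, map_add, inner_add_left, inner_add_right]
      ring
    -- Young's inequality, weighted to spend half of the dissipation `δ`.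
    have hy : 2 * (κ * ‖v‖ * ‖w‖) ≤ δ / 2 * ‖v‖ ^ 2 + 2 * κ ^ 2 / δ * ‖w‖ ^ 2 := by
      have h0 : δ / 2 * ‖v‖ ^ 2 + 2 * κ ^ 2 / δ * ‖w‖ ^ 2 - 2 * (κ * ‖v‖ * ‖w‖) =
          (δ * ‖v‖ - 2 * κ * ‖w‖) ^ 2 / (2 * δ) := by
        field_simp
        ring
      have h1 : 0 ≤ (δ * ‖v‖ - 2 * κ * ‖w‖) ^ 2 / (2 * δ) := by positivity
      linarith
    rw [hE]
    linarith
  have hmain := integral_mono (hXint.const_mul (δ / 2)) ((hbM.const_mul (2 * κ ^ 2 / δ)).sub hGint)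
    hpt
  -- The terminal energy can be dropped, which makes the bound uniform in `M`.
  have hfin : 0 ≤ ∫ ω, inner ℝ (V (α M ω) (X M ω)) (X M ω) ∂P :=
    integral_nonneg fun ω => hVpos _ _
  have hini : ∫ ω, inner ℝ (V (α 0 ω) (X 0 ω)) (X 0 ω) ∂P ≤ κ * ‖x‖ ^ 2 := by
    have hle : ∀ ω, ‖inner ℝ (V (α 0 ω) (X 0 ω)) (X 0 ω)‖ ≤ κ * ‖x‖ ^ 2 := fun ω => by
      have hx : X 0 ω = x := by simpa using hXeq ω 0
      rw [hx, sq, ← mul_assoc]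
      exact (norm_inner_le_norm _ _).trans (mul_le_mul_of_nonneg_right
        ((ContinuousLinearMap.le_opNorm _ _).trans
          (mul_le_mul_of_nonneg_right (hV _) (norm_nonneg _))) (norm_nonneg _))
    refine (Real.le_norm_self _).trans ((norm_integral_le_of_norm_le_const (ae_of_all _ hle)).trans
      (by simp))
  simp only [Pi.sub_apply] at hmain
  rw [integral_const_mul, integral_sub (hbM.const_mul _) hGint, integral_const_mul, ← hid] at hmain
  have hbm' := mul_le_mul_of_nonneg_left hbmono (show 0 ≤ 2 * κ ^ 2 / δ by positivity)
  have h3 : δ / 2 * ∫ p, ‖X p.1.toNNReal p.2‖ ^ 2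
      ∂((volume.restrict (Set.Ioc 0 (M : ℝ))).prod P) ≤
      κ * ‖x‖ ^ 2 + 2 * κ ^ 2 / δ * ∫ p, ‖b p.1.toNNReal p.2‖ ^ 2
        ∂((volume.restrict (Set.Ici (0 : ℝ))).prod P) := by linarith
  rw [div_mul_eq_mul_div, le_div_iff₀ hδ]
  linarith

end EnergyIdentity

/-! ### Condition (A) as a Lyapunov inequality. -/

section Lyapunov

/-- The form attains a negative maximum on the compact unit sphere, and homogeneity of degree two
extends the bound. The zero space is separate because its sphere is empty. -/
theorem exists_inner_le_neg_mul_norm_sq {E : Type*} [NormedAddCommGroup E] [InnerProductSpace ℝ E]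
    [FiniteDimensional ℝ E] (S : E →L[ℝ] E) (hS : ∀ v ≠ 0, inner ℝ (S v) v < 0) :
    ∃ δ > 0, ∀ v, inner ℝ (S v) v ≤ -δ * ‖v‖ ^ 2 := by
  rcases subsingleton_or_nontrivial E with h | h
  · exact ⟨1, one_pos, fun v => by simp [Subsingleton.elim v 0]⟩
  obtain ⟨w, hw, hmax⟩ := (isCompact_sphere (0 : E) 1).exists_isMaxOn
    (NormedSpace.sphere_nonempty.2 zero_le_one)
    (S.continuous.inner continuous_id : Continuous fun v => inner ℝ (S v) v).continuousOn
  have hw1 : ‖w‖ = 1 := by simpa using hw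
  refine ⟨-inner ℝ (S w) w, neg_pos.2 (hS w (norm_ne_zero_iff.1 (by simp [hw1]))), fun v => ?_⟩
  rcases eq_or_ne v 0 with rfl | hv
  · simp
  have hn : ‖v‖ ≠ 0 := norm_ne_zero_iff.2 hv
  have h1 : inner ℝ (S (‖v‖⁻¹ • v)) (‖v‖⁻¹ • v) ≤ inner ℝ (S w) w :=
    hmax (by simp [norm_smul, hn])
  rw [map_smul, real_inner_smul_left, real_inner_smul_right] at h1
  have h2 := mul_le_mul_of_nonneg_left h1 (sq_nonneg ‖v‖)
  calc inner ℝ (S v) v = ‖v‖ ^ 2 * (‖v‖⁻¹ * (‖v‖⁻¹ * inner ℝ (S v) v)) := by field_simp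
    _ ≤ _ := h2
    _ = _ := by ring

variable {D n : ℕ}

/-- A square matrix as a continuous operator on Euclidean space. -/
def matrixOp (N : Matrix (Fin n) (Fin n) ℝ) :
    EuclideanSpace ℝ (Fin n) →L[ℝ] EuclideanSpace ℝ (Fin n) :=
  N.toEuclideanLin.toContinuousLinearMap

theorem inner_matrixOp (N : Matrix (Fin n) (Fin n) ℝ) (v w : EuclideanSpace ℝ (Fin n)) :
    inner ℝ (matrixOp N v) w = w.ofLp ⬝ᵥ N.mulVec v.ofLp := by
  simp [matrixOp, EuclideanSpace.inner_eq_star_dotProduct, Matrix.ofLp_toLpLin]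

theorem inner_matrixOp_transpose (N : Matrix (Fin n) (Fin n) ℝ)
    (v w : EuclideanSpace ℝ (Fin n)) :
    inner ℝ (matrixOp N.transpose v) w = inner ℝ v (matrixOp N w) := by
  rw [real_inner_comm, real_inner_comm, inner_matrixOp, real_inner_comm, inner_matrixOp,
    Matrix.mulVec_transpose, dotProduct_comm, Matrix.dotProduct_mulVec]

theorem inner_matrixOp_pos {N : Matrix (Fin n) (Fin n) ℝ} (hN : N.PosDef)
    {v : EuclideanSpace ℝ (Fin n)} (hv : v ≠ 0) : 0 < inner ℝ (matrixOp N v) v := by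
  rw [inner_matrixOp]
  simpa using hN.dotProduct_mulVec_pos (x := v.ofLp) (by simpa using hv)

/-- As quadratic forms `P A` and `Aᵀ P` coincide, each giving `⟪P v, A v⟫`, hence the factor two.
Finitely many states allow one common `δ`, the smallest. -/
theorem ConditionA.exists_lyapunov {Q : Matrix (Fin D) (Fin D) ℝ}
    {A : Fin D → Matrix (Fin n) (Fin n) ℝ} (hA : ConditionA Q A) :
    ∃ V L : Fin D → EuclideanSpace ℝ (Fin n) →L[ℝ] EuclideanSpace ℝ (Fin n),
      (∀ j v w, inner ℝ (V j v) w = inner ℝ v (V j w)) ∧ (∀ j v, 0 ≤ inner ℝ (V j v) v) ∧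
      (∀ j v, inner ℝ (L j v) v = ∑ k, Q j k * inner ℝ (V k v) v) ∧
      ∃ δ > 0, ∀ j v, 2 * inner ℝ (V j v) (matrixOp (A j) v) + inner ℝ (L j v) v ≤
        -δ * ‖v‖ ^ 2 := by
  obtain ⟨M, hM, hneg⟩ := hA
  have hsymm : ∀ j v w, inner ℝ (matrixOp (M j) v) w = inner ℝ v (matrixOp (M j) w) := by
    intro j v w
    have h : (M j).transpose = M j := by
      simpa [Matrix.IsHermitian] using (hM j).isHermitian
    rw [← inner_matrixOp_transpose, h]
  refine ⟨fun j => matrixOp (M j), fun j => ∑ k, Q j k • matrixOp (M k), hsymm, fun j v => ?_,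
    fun j v => ?_, ?_⟩
  · rcases eq_or_ne v 0 with rfl | hv
    · simp
    · exact (inner_matrixOp_pos (hM j) hv).le
  · simp [sum_inner, real_inner_smul_left]
  · have key : ∀ j v, inner ℝ (matrixOp
        (-(M j * A j + (A j).transpose * M j + ∑ k, Q j k • M k)) v) v =
        -(2 * inner ℝ (matrixOp (M j) v) (matrixOp (A j) v) +
          inner ℝ ((∑ k, Q j k • matrixOp (M k)) v) v) := by
      intro j v
      have h1 : matrixOp (M j * A j) v = matrixOp (M j) (matrixOp (A j) v) := by
        simp [matrixOp, Matrix.toLpLin_apply]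
      have h2 : matrixOp ((A j).transpose * M j) v =
          matrixOp (A j).transpose (matrixOp (M j) v) := by
        simp [matrixOp, Matrix.toLpLin_apply]
      have h3 : matrixOp (-(M j * A j + (A j).transpose * M j + ∑ k, Q j k • M k)) =
          -(matrixOp (M j * A j) + matrixOp ((A j).transpose * M j) +
            ∑ k, Q j k • matrixOp (M k)) := by
        simp [matrixOp]
      rw [h3, neg_apply, inner_neg_left, add_apply,
        add_apply, h1, h2, inner_add_left, inner_add_left,
        inner_matrixOp_transpose, hsymm j (matrixOp (A j) v) v,
        real_inner_comm (matrixOp (M j) v) (matrixOp (A j) v)]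
      ring
    have hex : ∀ j, ∃ δ > 0, ∀ v, 2 * inner ℝ (matrixOp (M j) v) (matrixOp (A j) v) +
        inner ℝ ((∑ k, Q j k • matrixOp (M k)) v) v ≤ -δ * ‖v‖ ^ 2 := by
      intro j
      obtain ⟨δ, hδ, h⟩ := exists_inner_le_neg_mul_norm_sq
        (-matrixOp (-(M j * A j + (A j).transpose * M j + ∑ k, Q j k • M k))) fun v hv => by
          rw [neg_apply, inner_neg_left, neg_lt_zero]
          exact inner_matrixOp_pos (hneg j) hv
      refine ⟨δ, hδ, fun v => ?_⟩
      have := h v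
      rwa [neg_apply, inner_neg_left, key, neg_neg] at this
    choose δ hδ h using hex
    rcases isEmpty_or_nonempty (Fin D) with hD | hD
    · exact ⟨1, one_pos, fun j => hD.elim j⟩
    · obtain ⟨j₀, -, hj₀⟩ := Finset.exists_min_image Finset.univ δ Finset.univ_nonempty
      refine ⟨δ j₀, hδ j₀, fun j v => (h j v).trans ?_⟩
      have := hj₀ j (Finset.mem_univ j)
      gcongr

end Lyapunov

/-! ### Square integrability and Cauchy–Schwarz in time. -/

section SquareIntegrable

variable {E : Type*} [NormedAddCommGroup E]

theorem integrable_norm_sq_of_lintegral_enorm_sq {X : Type*} {mX : MeasurableSpace X}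
    {μ : Measure X} {f : X → E} (hf : AEStronglyMeasurable f μ) (h : ∫⁻ x, ‖f x‖ₑ ^ 2 ∂μ < ∞) :
    Integrable (fun x => ‖f x‖ ^ 2) μ := by
  refine ⟨hf.norm.pow 2, ?_⟩
  simpa [HasFiniteIntegral, enorm_pow] using h

theorem integrable_of_integrable_norm_sq {X : Type*} {mX : MeasurableSpace X}
    {μ : Measure X} [IsFiniteMeasure μ] {f : X → E} (hf : AEStronglyMeasurable f μ)
    (h : Integrable (fun x => ‖f x‖ ^ 2) μ) : Integrable f μ :=
  ((memLp_two_iff_integrable_sq_norm hf).2 h).integrable (by norm_num)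

/-- Expand the nonnegative integral of `(T |f| - I)²`, with `I` the integral of `|f|`. -/
theorem sq_integral_norm_le {f : ℝ → E} {T : ℝ} (hT : 0 ≤ T)
    (h1 : IntervalIntegrable (fun s => ‖f s‖) volume 0 T)
    (h2 : IntervalIntegrable (fun s => ‖f s‖ ^ 2) volume 0 T) :
    (∫ s in (0 : ℝ)..T, ‖f s‖) ^ 2 ≤ T * ∫ s in (0 : ℝ)..T, ‖f s‖ ^ 2 := by
  rcases hT.eq_or_lt with rfl | hT'
  · simp
  set I := ∫ s in (0 : ℝ)..T, ‖f s‖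
  set J := ∫ s in (0 : ℝ)..T, ‖f s‖ ^ 2
  have h0 : 0 ≤ ∫ s in (0 : ℝ)..T, (T * ‖f s‖ - I) ^ 2 :=
    intervalIntegral.integral_nonneg hT fun _ _ => sq_nonneg _
  have heq : ∫ s in (0 : ℝ)..T, (T * ‖f s‖ - I) ^ 2 = T * (T * J - I ^ 2) := by
    have : ∀ s, (T * ‖f s‖ - I) ^ 2 = T ^ 2 * ‖f s‖ ^ 2 - 2 * T * I * ‖f s‖ + I ^ 2 := fun s => by
      ring
    simp only [this]
    rw [intervalIntegral.integral_add ((h2.const_mul _).sub (h1.const_mul _))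
      intervalIntegrable_const, intervalIntegral.integral_sub (h2.const_mul _) (h1.const_mul _),
      intervalIntegral.integral_const_mul, intervalIntegral.integral_const_mul,
      intervalIntegral.integral_const]
    simp only [smul_eq_mul, sub_zero]
    ring
  rw [heq] at h0
  linarith [nonneg_of_mul_nonneg_right h0 hT']

end SquareIntegrable

/-! ### Null sets in the augmented filtration. -/

section NullSets

variable {Ω : Type*} {mΩ : MeasurableSpace Ω} {P : Measure Ω} {D : ℕ} {α : ℝ≥0 → Ω → Fin D}
  {hα : ∀ t, Measurable (α t)}

theorem measurableSet_augmentedFiltration {s : Set Ω} (hs : MeasurableSet s) (h : P sᶜ = 0)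
    (t : ℝ≥0) : MeasurableSet[augmentedFiltration P α hα t] s := by
  have h1 : MeasurableSet[MeasurableSpace.generateFrom {N : Set Ω | MeasurableSet N ∧ P N = 0}]
      sᶜ := MeasurableSpace.measurableSet_generateFrom ⟨hs.compl, h⟩
  have h2 : MeasurableSet[augmentedFiltration P α hα t] sᶜ :=
    (le_sup_right : _ ≤ augmentedFiltration P α hα t) _ h1
  simpa using h2.compl

theorem measurable_augmentedFiltration (t : ℝ≥0) :
    Measurable[augmentedFiltration P α hα t] (α t) := by
  have h := (Filtration.stronglyAdapted_natural (u := α) fun s => (hα s).stronglyMeasurable) t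
  exact h.measurable.mono le_sup_left le_rfl

theorem exists_measurableSet_of_ae {p : Ω → Prop} (hp : ∀ᵐ ω ∂P, p ω) :
    ∃ s, MeasurableSet s ∧ P sᶜ = 0 ∧ ∀ ω ∈ s, p ω := by
  obtain ⟨t, ht, hmt, h0⟩ := exists_measurable_superset_of_null (ae_iff.1 hp)
  refine ⟨tᶜ, hmt.compl, by simpa using h0, fun ω hω => ?_⟩
  by_contra hn
  exact hω (ht hn)

end NullSets

/-! ### The solution process: pathwise properties and measurability. -/

section Solution

variable {Ω : Type*} {mΩ : MeasurableSpace Ω} {P : Measure Ω} {D : ℕ}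
  {E : Type*} [NormedAddCommGroup E] [NormedSpace ℝ E]

/-- The solution of `X' = B(α) X + b`, `X 0 = x`. -/
def switchingSolution (B : Fin D → E →L[ℝ] E) (α : ℝ≥0 → Ω → Fin D) (b : ℝ≥0 → Ω → E) (x : E)
    (t : ℝ≥0) (ω : Ω) : E :=
  picardSum (fun s => B (α s ω)) (fun r => x + ∫ s in (0 : ℝ)..r, b s.toNNReal ω) t

theorem continuous_const_add_integral {β : ℝ≥0 → E} (x : E)
    (hβ : ∀ t : ℝ≥0, IntervalIntegrable (fun s : ℝ => β s.toNNReal) volume 0 t) :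
    Continuous fun r : ℝ≥0 => x + ∫ s in (0 : ℝ)..r, β s.toNNReal :=
  continuous_const.add (continuous_integral_toNNReal hβ)

theorem stronglyMeasurable_path {α : ℝ≥0 → Ω → Fin D}
    (hα : Measurable fun p : ℝ≥0 × Ω => α p.1 p.2) (B : Fin D → E →L[ℝ] E) (ω : Ω) :
    StronglyMeasurable fun t => B (α t ω) :=
  (StronglyMeasurable.of_discrete (f := B)).comp_measurable (hα.comp measurable_prodMk_right)

/-- This provides the integrable majorant `ρ` of the energy argument. Its exponential growth in `T`
is harmless, because `ρ` serves only for domination and is absent from the final estimate. -/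
theorem norm_switchingSolution_sq_le {B : Fin D → E →L[ℝ] E} {κ : ℝ}
    (hB : ∀ j, ‖B j‖ ≤ κ) {α : ℝ≥0 → Ω → Fin D} {b : ℝ≥0 → Ω → E} {ω : Ω} {T : ℝ≥0}
    (hb : IntervalIntegrable (fun s : ℝ => b s.toNNReal ω) volume 0 T)
    (hb2 : IntervalIntegrable (fun s : ℝ => ‖b s.toNNReal ω‖ ^ 2) volume 0 T) (x : E)
    {t : ℝ≥0} (ht : t ≤ T) :
    ‖switchingSolution B α b x t ω‖ ^ 2 ≤
      Real.exp (κ * T) ^ 2 * (2 * ‖x‖ ^ 2 + 2 * (T * ∫ s in (0 : ℝ)..T, ‖b s.toNNReal ω‖ ^ 2)) := by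
  set I := ∫ s in (0 : ℝ)..T, ‖b s.toNNReal ω‖ with hI
  have hy : ∀ r ≤ T, ‖x + ∫ s in (0 : ℝ)..r, b s.toNNReal ω‖ ≤ ‖x‖ + I := fun r hr => by
    refine (norm_add_le _ _).trans (add_le_add_right ?_ _)
    refine (intervalIntegral.norm_integral_le_integral_norm r.coe_nonneg).trans ?_
    exact intervalIntegral.integral_mono_interval le_rfl r.coe_nonneg (by exact_mod_cast hr)
      (ae_of_all _ fun _ => norm_nonneg _) hb.norm
  have h1 : ‖switchingSolution B α b x t ω‖ ≤ (‖x‖ + I) * Real.exp (κ * T) :=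
    norm_picardSum_le (fun t => hB (α t ω)) hy ht
  have h2 : I ^ 2 ≤ T * ∫ s in (0 : ℝ)..T, ‖b s.toNNReal ω‖ ^ 2 :=
    sq_integral_norm_le T.coe_nonneg hb.norm hb2
  calc ‖switchingSolution B α b x t ω‖ ^ 2 ≤ ((‖x‖ + I) * Real.exp (κ * T)) ^ 2 := by gcongr
    _ = Real.exp (κ * T) ^ 2 * (‖x‖ + I) ^ 2 := by ring
    _ ≤ _ := by
      refine mul_le_mul_of_nonneg_left ?_ (sq_nonneg _)
      nlinarith [sq_nonneg (‖x‖ - I)]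

variable [CompleteSpace E]

theorem intervalIntegrable_switchingSolution {B : Fin D → E →L[ℝ] E} {κ : ℝ}
    (hB : ∀ j, ‖B j‖ ≤ κ) {α : ℝ≥0 → Ω → Fin D} (hα : Measurable fun p : ℝ≥0 × Ω => α p.1 p.2)
    {b : ℝ≥0 → Ω → E} {ω : Ω}
    (hb : ∀ t : ℝ≥0, IntervalIntegrable (fun s : ℝ => b s.toNNReal ω) volume 0 t) (x : E)
    (t : ℝ≥0) :
    IntervalIntegrable (fun s : ℝ => B (α s.toNNReal ω)
      (switchingSolution B α b x s.toNNReal ω) + b s.toNNReal ω) volume 0 t :=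
  (intervalIntegrable_apply_picardSum (stronglyMeasurable_path hα B ω) (fun t => hB (α t ω))
    (continuous_const_add_integral (β := fun s => b s ω) x hb) t).add (hb t)

theorem switchingSolution_eq {B : Fin D → E →L[ℝ] E} {κ : ℝ}
    (hB : ∀ j, ‖B j‖ ≤ κ) {α : ℝ≥0 → Ω → Fin D} (hα : Measurable fun p : ℝ≥0 × Ω => α p.1 p.2)
    {b : ℝ≥0 → Ω → E} {ω : Ω}
    (hb : ∀ t : ℝ≥0, IntervalIntegrable (fun s : ℝ => b s.toNNReal ω) volume 0 t) (x : E)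
    (t : ℝ≥0) :
    switchingSolution B α b x t ω = x + ∫ s in (0 : ℝ)..t, (B (α s.toNNReal ω)
      (switchingSolution B α b x s.toNNReal ω) + b s.toNNReal ω) := by
  have hy := continuous_const_add_integral (β := fun s => b s ω) x hb
  have hm := stronglyMeasurable_path hα B ω
  simp only [switchingSolution]
  rw [intervalIntegral.integral_add
    (intervalIntegrable_apply_picardSum hm (fun t => hB (α t ω)) hy t) (hb t)]
  refine (picardSum_eq hm (fun t => hB (α t ω)) hy t).trans ?_
  rw [add_assoc, add_comm (∫ s in (0 : ℝ)..t, b s.toNNReal ω)]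

theorem continuous_switchingSolution {B : Fin D → E →L[ℝ] E} {κ : ℝ}
    (hB : ∀ j, ‖B j‖ ≤ κ) {α : ℝ≥0 → Ω → Fin D} (hα : Measurable fun p : ℝ≥0 × Ω => α p.1 p.2)
    {b : ℝ≥0 → Ω → E} {ω : Ω}
    (hb : ∀ t : ℝ≥0, IntervalIntegrable (fun s : ℝ => b s.toNNReal ω) volume 0 t) (x : E) :
    Continuous fun t => switchingSolution B α b x t ω :=
  continuous_picardSum (stronglyMeasurable_path hα B ω) (fun t => hB (α t ω))
    (continuous_const_add_integral (β := fun s => b s ω) x hb)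

variable [MeasurableSpace E] [BorelSpace E] [SecondCountableTopology E]

theorem isProgressive_switchingSolution {𝔽 : Filtration ℝ≥0 mΩ} (B : Fin D → E →L[ℝ] E)
    {α : ℝ≥0 → Ω → Fin D} (hα : IsProgressive 𝔽 α) {b : ℝ≥0 → Ω → E} (hb : IsProgressive 𝔽 b)
    (x : E) : IsProgressive 𝔽 (switchingSolution B α b x) :=
  isProgressive_tsum fun k => isProgressive_picardTerm B hα
    ((isProgressive_const 𝔽 x).add (isProgressive_integral hb)) k

end Solution

/-! ### Square integrability of the solution on the half-line. -/

section MeanSquare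

variable {Ω : Type*} {mΩ : MeasurableSpace Ω} {P : Measure Ω} [IsProbabilityMeasure P] {D : ℕ}
  {E : Type*} [NormedAddCommGroup E] [InnerProductSpace ℝ E] [CompleteSpace E]
  [MeasurableSpace E] [BorelSpace E] [SecondCountableTopology E]

theorem lintegral_switchingSolution_lt_top {𝔽 : Filtration ℝ≥0 mΩ} {Q : Matrix (Fin D) (Fin D) ℝ}
    {V B L : Fin D → E →L[ℝ] E}
    (hVsymm : ∀ j v w, inner ℝ (V j v) w = inner ℝ v (V j w))
    (hVpos : ∀ j v, 0 ≤ inner ℝ (V j v) v)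
    (hLV : ∀ j v, inner ℝ (L j v) v = ∑ k, Q j k * inner ℝ (V k v) v)
    {δ : ℝ} (hδ : 0 < δ)
    (hLyap : ∀ j v, 2 * inner ℝ (V j v) (B j v) + inner ℝ (L j v) v ≤ -δ * ‖v‖ ^ 2)
    {α : ℝ≥0 → Ω → Fin D} (hM : HasMarkovProperty P 𝔽 Q α) (hαprog : IsProgressive 𝔽 α)
    (hαcont : ∀ ω t, ContinuousWithinAt (fun s => α s ω) (Set.Ioi t) t)
    {b : ℝ≥0 → Ω → E} (hbprog : IsProgressive 𝔽 b)
    (hb : ∀ ω, ∀ t : ℝ≥0, IntervalIntegrable (fun s : ℝ => b s.toNNReal ω) volume 0 t)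
    (hb2 : ∀ ω, ∀ t : ℝ≥0, IntervalIntegrable (fun s : ℝ => ‖b s.toNNReal ω‖ ^ 2) volume 0 t)
    (hbi : Integrable (fun p : ℝ × Ω => ‖b p.1.toNNReal p.2‖ ^ 2)
      ((volume.restrict (Set.Ici 0)).prod P)) (x : E) :
    ∫⁻ ω, (∫⁻ t in Set.Ici (0 : ℝ), ‖switchingSolution B α b x t.toNNReal ω‖ₑ ^ 2) ∂P < ∞ := by
  -- A single constant bounding all three finite families of operators.
  set κ : ℝ := ∑ j, (‖V j‖ + ‖B j‖ + ‖L j‖) with hκ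
  have hle : ∀ j, ‖V j‖ + ‖B j‖ + ‖L j‖ ≤ κ := fun j =>
    Finset.single_le_sum (f := fun j => ‖V j‖ + ‖B j‖ + ‖L j‖) (fun j _ => by positivity)
      (Finset.mem_univ j)
  have hV : ∀ j, ‖V j‖ ≤ κ := fun j => by
    linarith [hle j, norm_nonneg (V j), norm_nonneg (B j), norm_nonneg (L j)]
  have hB : ∀ j, ‖B j‖ ≤ κ := fun j => by
    linarith [hle j, norm_nonneg (V j), norm_nonneg (B j), norm_nonneg (L j)]
  have hL : ∀ j, ‖L j‖ ≤ κ := fun j => by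
    linarith [hle j, norm_nonneg (V j), norm_nonneg (B j), norm_nonneg (L j)]
  set X := switchingSolution B α b x with hXdef
  have hα := measurable_uncurry_of_isProgressive hαprog
  have hbm := measurable_uncurry_of_isProgressive hbprog
  have hXprog : IsProgressive 𝔽 X := isProgressive_switchingSolution B hαprog hbprog x
  have hX := measurable_uncurry_of_isProgressive hXprog
  have hpu : Measurable fun p : ℝ × Ω => (p.1.toNNReal, p.2) := by fun_prop
  set C : ℝ := 2 / δ * (κ * ‖x‖ ^ 2 + 2 * κ ^ 2 / δ * ∫ p, ‖b p.1.toNNReal p.2‖ ^ 2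
        ∂((volume.restrict (Set.Ici (0 : ℝ))).prod P)) with hC
  have hbound : ∀ M : ℕ, ∫⁻ p in Set.Ioc 0 (M : ℝ) ×ˢ Set.univ, ‖X p.1.toNNReal p.2‖ₑ ^ 2
      ∂(volume.prod P) ≤ ENNReal.ofReal C := by
    intro M
    have hρ : Integrable (fun ω => Real.exp (κ * (M : ℝ≥0)) ^ 2 * (2 * ‖x‖ ^ 2 +
        2 * ((M : ℝ≥0) * ∫ s in (0 : ℝ)..(M : ℝ≥0), ‖b s.toNNReal ω‖ ^ 2))) P := by
      have hbM : Integrable (fun p : ℝ × Ω => ‖b p.1.toNNReal p.2‖ ^ 2)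
          ((volume.restrict (Set.Ioc 0 ((M : ℝ≥0) : ℝ))).prod P) := by
        simpa using integrable_const_mul_add_const_mul (P := P) (integrable_const (0 : ℝ)) hbi
          (S := Set.Ioc 0 (M : ℝ)) (fun u hu => hu.1.le) (by simp) 0 1
      refine Integrable.const_mul ((integrable_const _).add
        (Integrable.const_mul (Integrable.const_mul ?_ _) _)) _
      simp only [intervalIntegral.integral_of_le (NNReal.coe_nonneg _)]
      exact hbM.integral_prod_right
    obtain ⟨hi, hle⟩ := integral_norm_sq_le (M := M) hV hB hL hVsymm hVpos hLV hδ hLyap hM hαcont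
      hα hbm hX (fun t => hXprog.adapted t)
      (fun ω => continuous_switchingSolution hB hα (hb ω) x) hρ
      (fun t ht ω => norm_switchingSolution_sq_le hB (hb ω M) (hb2 ω M) x ht) hbi
      (fun ω => intervalIntegrable_switchingSolution hB hα (hb ω) x)
      (fun ω => switchingSolution_eq hB hα (hb ω) x)
    rw [← restrict_prod_eq]
    refine le_trans (le_of_eq ?_) (ENNReal.ofReal_le_ofReal hle)
    rw [ofReal_integral_eq_lintegral_ofReal hi (ae_of_all _ fun _ => by positivity)]
    refine lintegral_congr fun p => ?_
    rw [ENNReal.ofReal_pow (norm_nonneg _), ofReal_norm]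
  have hmeas : Measurable fun p : ℝ × Ω => ‖X p.1.toNNReal p.2‖ₑ ^ 2 :=
    (hX.comp hpu).enorm.pow_const 2
  have hunion : Set.Ioi (0 : ℝ) ×ˢ (Set.univ : Set Ω) =
      ⋃ M : ℕ, Set.Ioc 0 (M : ℝ) ×ˢ Set.univ := by
    ext p
    simp only [Set.mem_prod, Set.mem_Ioi, Set.mem_univ, and_true, Set.mem_iUnion, Set.mem_Ioc,
      exists_and_left, iff_self_and]
    exact fun _ => exists_nat_ge p.1
  -- Up to the null time `0` the half-line is the increasing union of the intervals `(0, M]`, so the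
  -- bound `C`, free of `M`, passes to the limit.
  rw [← lintegral_prod_symm' (μ := volume.restrict (Set.Ici (0 : ℝ))) _ hmeas,
    Measure.restrict_congr_set Ioi_ae_eq_Ici.symm, restrict_prod_eq, hunion,
    setLIntegral_iUnion_of_directed]
  · exact (iSup_le hbound).trans_lt ENNReal.ofReal_lt_top
  · refine directed_of_isDirected_le fun M N hMN => Set.prod_mono_left (Set.Ioc_subset_Ioc_right ?_)
    exact_mod_cast hMN

end MeanSquare

end RegimeSwitching

/-! ### Existence, square integrability and uniqueness. -/

open RegimeSwitching in
theorem mainTheorem4 {Ω : Type*} {mΩ : MeasurableSpace Ω} (P : Measure Ω)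
    [IsProbabilityMeasure P] [P.IsComplete] {D n : ℕ}
    (Q : Matrix (Fin D) (Fin D) ℝ)
    (α : ℝ≥0 → Ω → Fin D) (hα : ∀ t, Measurable (α t))
    (hchain : RegimeSwitching.IsMarkovChain P Q α hα)
    (A : Fin D → Matrix (Fin n) (Fin n) ℝ)
    (hA : RegimeSwitching.ConditionA Q A)
    (b : ℝ≥0 → Ω → EuclideanSpace ℝ (Fin n))
    (hb : RegimeSwitching.MemL2F P (RegimeSwitching.augmentedFiltration P α hα) b)
    (x : EuclideanSpace ℝ (Fin n)) (i : Fin D) (hi : ∀ᵐ ω ∂P, α 0 ω = i) :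
    ∃ X : ℝ≥0 → Ω → EuclideanSpace ℝ (Fin n),
      RegimeSwitching.MemL2F P (RegimeSwitching.augmentedFiltration P α hα) X ∧
      RegimeSwitching.IsSolution P A α b x X ∧
      ∀ Y : ℝ≥0 → Ω → EuclideanSpace ℝ (Fin n),
        RegimeSwitching.IsSolution P A α b x Y → ∀ᵐ ω ∂P, ∀ t, Y t ω = X t ω := by
  classical
  set 𝔽 := augmentedFiltration P α hα with h𝔽
  obtain ⟨V, L, hVsymm, hVpos, hLV, δ, hδ, hLyap⟩ := hA.exists_lyapunov
  have hpu : Measurable fun p : ℝ × Ω => (p.1.toNNReal, p.2) := by fun_prop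
  have hbm := measurable_uncurry_of_isProgressive hb.1
  have hbsq : Measurable fun p : ℝ × Ω => ‖b p.1.toNNReal p.2‖ₑ ^ 2 :=
    (hbm.comp hpu).enorm.pow_const 2
  have hgood : ∀ᵐ ω ∂P, (∀ t : ℝ≥0, ContinuousWithinAt (fun s => α s ω) (Set.Ioi t) t) ∧
      ∫⁻ t in Set.Ici (0 : ℝ), ‖b t.toNNReal ω‖ₑ ^ 2 < ∞ := by
    filter_upwards [hchain.cadlag, ae_lt_top (hbsq.lintegral_prod_left'
      (μ := volume.restrict (Set.Ici (0 : ℝ)))) hb.2.ne] with ω h1 h2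
    exact ⟨fun t => (h1 t).1, h2⟩
  -- Off the full-measure set `S` the chain is made constant and `b` zero, so path properties hold
  -- for every `ω`. The augmentation puts `S` in every `𝔽 t`, which preserves progressiveness, and
  -- the Markov property ignores null sets.
  obtain ⟨S, hS, hS0, hSgood⟩ := exists_measurableSet_of_ae hgood
  have hS𝔽 : ∀ t, MeasurableSet[𝔽 t] S := measurableSet_augmentedFiltration hS hS0
  have hSae : ∀ᵐ ω ∂P, ω ∈ S := hS0
  set α' : ℝ≥0 → Ω → Fin D := fun t ω => if ω ∈ S then α t ω else i with hαMod
  set bMod : ℝ≥0 → Ω → EuclideanSpace ℝ (Fin n) := fun t => S.indicator (b t) with hbMod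
  have hαModeq : ∀ ω ∈ S, ∀ t, α' t ω = α t ω := fun ω hω t => if_pos hω
  have hbModeq : ∀ ω ∈ S, ∀ t, bMod t ω = b t ω := fun ω hω t => Set.indicator_of_mem hω _
  have hαModcont : ∀ ω t, ContinuousWithinAt (fun s => α' s ω) (Set.Ioi t) t := fun ω t => by
    by_cases hω : ω ∈ S
    · simpa only [hαModeq ω hω] using (hSgood ω hω).1 t
    · simp only [hαMod, if_neg hω]
      exact continuousWithinAt_const
  have hαModprog : IsProgressive 𝔽 α' := isProgressive_of_rightContinuous (fun t =>
    Measurable.ite (hS𝔽 t) (measurable_augmentedFiltration t) measurable_const) hαModcont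
  have hbModprog : IsProgressive 𝔽 bMod := isProgressive_indicator hb.1 hS𝔽
  have hbModm := measurable_uncurry_of_isProgressive hbModprog
  have hMarkov : HasMarkovProperty P 𝔽 Q α' := fun s t hst j => by
    refine (condExp_congr_ae ?_).trans ((hchain.markov s t hst j).trans ?_)
    · filter_upwards [hSae] with ω hω
      simp [Set.indicator_apply, hαModeq ω hω]
    · filter_upwards [hSae] with ω hω
      rw [hαModeq ω hω]
  have hbModfin : ∀ ω, ∫⁻ t in Set.Ici (0 : ℝ), ‖bMod t.toNNReal ω‖ₑ ^ 2 < ∞ := fun ω => by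
    by_cases hω : ω ∈ S
    · simpa only [hbModeq ω hω] using (hSgood ω hω).2
    · simp [hbMod, Set.indicator_of_notMem hω]
  have hpath : ∀ ω, Measurable fun s : ℝ => bMod s.toNNReal ω := fun ω =>
    hbModm.comp (measurable_real_toNNReal.prodMk measurable_const)
  have hbMod2 : ∀ ω, ∀ t : ℝ≥0,
      IntervalIntegrable (fun s : ℝ => ‖bMod s.toNNReal ω‖ ^ 2) volume 0 t := fun ω t => by
    rw [intervalIntegrable_iff_integrableOn_Ioc_of_le t.coe_nonneg]
    exact IntegrableOn.mono_set (integrable_norm_sq_of_lintegral_enorm_sq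
      (hpath ω).aestronglyMeasurable (hbModfin ω)) fun u hu => hu.1.le
  have hbMod1 : ∀ ω, ∀ t : ℝ≥0,
      IntervalIntegrable (fun s : ℝ => bMod s.toNNReal ω) volume 0 t := fun ω t => by
    have h2 := hbMod2 ω t
    rw [intervalIntegrable_iff_integrableOn_Ioc_of_le t.coe_nonneg] at h2 ⊢
    exact integrable_of_integrable_norm_sq (hpath ω).aestronglyMeasurable h2
  have hbModi : Integrable (fun p : ℝ × Ω => ‖bMod p.1.toNNReal p.2‖ ^ 2)
      ((volume.restrict (Set.Ici 0)).prod P) := by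
    refine integrable_norm_sq_of_lintegral_enorm_sq (hbModm.comp hpu).aestronglyMeasurable ?_
    have hmeas : Measurable fun p : ℝ × Ω => ‖bMod p.1.toNNReal p.2‖ₑ ^ 2 :=
      (hbModm.comp hpu).enorm.pow_const 2
    rw [lintegral_prod_symm' _ hmeas]
    refine lt_of_eq_of_lt (lintegral_congr_ae ?_) hb.2
    filter_upwards [hSae] with ω hω
    simp only [hbModeq ω hω]
  set B : Fin D → EuclideanSpace ℝ (Fin n) →L[ℝ] EuclideanSpace ℝ (Fin n) :=
    fun j => matrixOp (A j) with hBdef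
  set κ : ℝ := ∑ j, ‖B j‖ with hκ
  have hB : ∀ j, ‖B j‖ ≤ κ := fun j =>
    Finset.single_le_sum (f := fun j => ‖B j‖) (fun j _ => norm_nonneg _) (Finset.mem_univ j)
  have hαModm := measurable_uncurry_of_isProgressive hαModprog
  have hsol : IsSolution P A α b x (switchingSolution B α' bMod x) := by
    filter_upwards [hSae] with ω hω t
    have h1 := intervalIntegrable_switchingSolution hB hαModm (hbMod1 ω) x t
    have h2 := switchingSolution_eq hB hαModm (hbMod1 ω) x t
    simp only [hαModeq ω hω, hbModeq ω hω] at h1 h2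
    exact ⟨h1, h2⟩
  refine ⟨switchingSolution B α' bMod x, ⟨isProgressive_switchingSolution B hαModprog hbModprog x,
    lintegral_switchingSolution_lt_top hVsymm hVpos hLV hδ hLyap hMarkov hαModprog hαModcont hbModprog
      hbMod1 hbMod2 hbModi x⟩, hsol, fun Y hY => ?_⟩
  filter_upwards [hsol, hY] with ω hXω hYω t
  -- The forcing `b` cancels in the difference of the two right-hand sides, leaving the homogeneous
  -- equation with zero initial value.
  have hdiff : ∀ s, B (α s ω) (Y s ω - switchingSolution B α' bMod x s ω) =
      ((A (α s ω)).toEuclideanLin (Y s ω) + b s ω) -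
      ((A (α s ω)).toEuclideanLin (switchingSolution B α' bMod x s ω) + b s ω) := fun s => by
    rw [map_sub, add_sub_add_right_eq_sub]
    rfl
  refine sub_eq_zero.1 (eq_zero_of_eq_integral (a := fun s => B (α s ω))
    (f := fun s => Y s ω - switchingSolution B α' bMod x s ω) (fun s => hB _) (fun t => ?_)
    (fun t => ?_) t)
  · simp only [hdiff]
    exact (hYω t).1.sub (hXω t).1
  · simp only [hdiff]
    rw [intervalIntegral.integral_sub (hYω t).1 (hXω t).1, (hYω t).2]
    nth_rw 1 [(hXω t).2]
    rw [add_sub_add_left_eq_sub]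

end
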